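/- **Discrete maximal parabolic regularity for $p=1$.** Let $\Omega\subset\mathbb R^d$, $d\ge 1$, be a bounded Lipschitz domain, $T>0$ and $I=(0,T)$. Let $a_{ij}=a_{ji}\in L^\infty(I\times\Omega)$, $1\le i,j\le d$, be continuous in $t\in[0,T]$ for almost all $x\in\Omega$, with $\sum_{i,j}a_{ij}(t,x)\xi_i\xi_j\ge\alpha|\xi|^2$ for all $\xi\in\mathbb R^d$ and a.e. $(t,x)\in I\times\Omega$, where $\alpha>0$, and with $$|a_{ij}(t_1,x)-a_{ij}(t_2,x)|\le\omega(|t_1-t_2|)\quad\text{for all }t_1,t_2\in[0,T]\text{ and almost all }x\in\Omega,$$ where $\omega:[0,T]\to[0,\infty)$ is nondecreasing, $\omega(t)/t^{3/2}$ is nonincreasing on $(0,T]$, and $\int_0^T\omega(t)\,t^{-3/2}\,dt<\infty$. Put $a(t;u,v)=\int_\Omega\sum_{i,j}a_{ij}(t,x)\,\partial_iu\,\partial_jv\,dx$ and $\langle A(t)u,v\rangle=a(t;u,v)$ for $u,v\in H^1_0(\Omega)$, so that $A(t):H^1_0(\Omega)\to H^{-1}(\Omega)$. For a time mesh $0=t_0<t_1<\dots<t_M=T$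 let $I_m=(t_{m-1},t_m]$, $k_m=t_m-t_{m-1}$, $k=\max_mk_m$, $k_{\min}=\min_mk_m$ and $A_{k,m}=\frac1{k_m}\int_{I_m}A(t)\,dt$. Fix constants $c,\beta,\kappa>0$ and call the mesh admissible if $k_{\min}\ge ck^\beta$, $\kappa^{-1}\le k_m/k_{m+1}\le\kappa$ for $1\le m\le M-1$, and $k\le T/4$. Let $X_k^0$ be the space of functions on $(0,T]$ with values in $H^1_0(\Omega)$ that are constant on each $I_m$; for $v\in X_k^0$ write $v_{k,m}=v|_{I_m}$. For $f\in L^1(I;L^2(\Omega))$ and $u_0\in L^2(\Omega)$, the dG(0) solution is the $u_k\in X_k^0$ with $$\int_0^Ta(t;u_k(t),\varphi_k(t))\,dt+\sum_{m=2}^M(u_{k,m}-u_{k,m-1},\varphi_{k,m})_{\Omega}+(u_{k,1},\varphi_{k,1})_{\Omega}=\int_0^T(f(t),\varphi_k(t))_{\Omega}\,dt+(u_0,\varphi_{k,1})_{\Omega}$$ for all $\varphi_k\in X_k^0$, where $(\cdot,\cdot)_\Omega$ is the inner product of $L^2(\Omega)$. Let $[u_k]_{m-1}=u_{k,m}-u_{k,m-1}$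 for $2\le m\le M$ and $[u_k]_0=u_{k,1}-u_0$. Then there is a constant $C>0$, and for all sufficiently large $\mu>0$ there is $\delta_0>0$, with $C$, $\mu$ and $\delta_0$ independent of the mesh, of $f$ and of $u_0$, and $C$ independent of $\mu$, such that for every admissible mesh with $k-k_{\min}\le\delta_0$, every $f\in L^1(I;L^2(\Omega))$ and every $u_0\in L^2(\Omega)$, the dG(0) solution satisfies $A_{k,m}u_{k,m}\in L^2(\Omega)$ for $1\le m\le M$ and $$\sum_{m=1}^M\Big(k_m\|A_{k,m}u_{k,m}\|_{L^2(\Omega)}+\|[u_k]_{m-1}\|_{L^2(\Omega)}\Big)\le C\,e^{\mu T}\ln\frac Tk\,\Big(\|f\|_{L^1(I;L^2(\Omega))}+\|u_0\|_{L^2(\Omega)}\Big).$$ -/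

import Mathlib

open MeasureTheory Set
open scoped RealInnerProductSpace

noncomputable section

namespace DGParabolic

/-- A bounded Lipschitz domain of `ℝ^d`: a bounded, connected, nonempty open set that, near every
boundary point, is the set of points above the graph of a Lipschitz function in some direction `ν`
(`y - ⟪ν, y⟫ • ν` is the component of `y` in the hyperplane orthogonal to `ν`). -/
structure IsLipschitzDomain {d : ℕ} (Ω : Set (EuclideanSpace ℝ (Fin d))) : Prop where
  isOpen : IsOpen Ω
  isConnected : IsConnected Ω
  isBounded : Bornology.IsBounded Ω
  boundary : ∀ x ∈ frontier Ω, ∃ (ν : EuclideanSpace ℝ (Fin d)) (r : ℝ) (K : NNReal)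
    (γ : EuclideanSpace ℝ (Fin d) → ℝ), ‖ν‖ = 1 ∧ 0 < r ∧ LipschitzWith K γ ∧
      ∀ y ∈ Metric.ball x r, y ∈ Ω ↔ γ (y - ⟪ν, y⟫ • ν) < ⟪ν, y⟫

/-- The real Hilbert space `L²(Ω)`. -/
abbrev L2 {d : ℕ} (Ω : Set (EuclideanSpace ℝ (Fin d))) : Type :=
  Lp ℝ 2 (volume.restrict Ω)

/-- The real Hilbert space `L²(Ω)^d` of square integrable vector fields. -/
abbrev L2Vec {d : ℕ} (Ω : Set (EuclideanSpace ℝ (Fin d))) : Type :=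
  Lp (EuclideanSpace ℝ (Fin d)) 2 (volume.restrict Ω)

/-- The pairs `(φ, ∇φ)` for `φ ∈ C_c^∞(Ω)`, inside `L²(Ω) × L²(Ω)^d` with the Hilbert norm
`(‖u‖² + ‖g‖²)^(1/2)`, which on these pairs is the `H¹(Ω)` norm of `φ`. -/
def testPairs {d : ℕ} (Ω : Set (EuclideanSpace ℝ (Fin d))) :
    Set (WithLp 2 (L2 Ω × L2Vec Ω)) :=
  {p | ∃ φ : EuclideanSpace ℝ (Fin d) → ℝ, ContDiff ℝ (⊤ : ℕ∞) φ ∧ HasCompactSupport φ ∧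
    tsupport φ ⊆ Ω ∧ (p.fst : EuclideanSpace ℝ (Fin d) → ℝ) =ᵐ[volume.restrict Ω] φ ∧
    (p.snd : EuclideanSpace ℝ (Fin d) → EuclideanSpace ℝ (Fin d))
      =ᵐ[volume.restrict Ω] fun x => gradient φ x}

/-- `H¹₀(Ω)`, the closure of `C_c^∞(Ω)` in the `H¹` norm. An element is stored as the pair
`(u, ∇u)` of a function and its weak gradient, so this is a closed subspace of
`L²(Ω) × L²(Ω)^d`, and its norm is the `H¹(Ω)` norm. -/
def H10 {d : ℕ} (Ω : Set (EuclideanSpace ℝ (Fin d))) :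
    Submodule ℝ (WithLp 2 (L2 Ω × L2Vec Ω)) :=
  (Submodule.span ℝ (testPairs Ω)).topologicalClosure

/-- The embedding `H¹₀(Ω) → L²(Ω)`. -/
def toL2 {d : ℕ} {Ω : Set (EuclideanSpace ℝ (Fin d))} (u : H10 Ω) : L2 Ω :=
  (u : WithLp 2 (L2 Ω × L2Vec Ω)).fst

/-- The weak gradient of an element of `H¹₀(Ω)`. -/
def weakGrad {d : ℕ} {Ω : Set (EuclideanSpace ℝ (Fin d))} (u : H10 Ω) : L2Vec Ω :=
  (u : WithLp 2 (L2 Ω × L2Vec Ω)).snd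

/-- The modulus of continuity `ω : [0,T] → [0,∞)`: nondecreasing, with `ω(t) / t^(3/2)`
nonincreasing and integrable on `(0,T]`. -/
structure IsModulus (T : ℝ) (ω : ℝ → ℝ) : Prop where
  nonneg : ∀ t ∈ Icc 0 T, 0 ≤ ω t
  monotoneOn : MonotoneOn ω (Icc 0 T)
  antitoneOn : AntitoneOn (fun t => ω t / t ^ (3 / 2 : ℝ)) (Ioc 0 T)
  integrableOn : IntegrableOn (fun t => ω t / t ^ (3 / 2 : ℝ)) (Ioc 0 T)

/-- The assumptions on the coefficients `a i j t x = a_ij(t,x)`, for `t ∈ [0,T]` and `x ∈ Ω`. -/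
structure IsAdmissibleCoeff {d : ℕ} (Ω : Set (EuclideanSpace ℝ (Fin d))) (T α : ℝ) (ω : ℝ → ℝ)
    (a : Fin d → Fin d → ℝ → EuclideanSpace ℝ (Fin d) → ℝ) : Prop where
  memLp : ∀ i j, MemLp (fun p : ℝ × EuclideanSpace ℝ (Fin d) => a i j p.1 p.2) ⊤
    ((volume.restrict (Ioo 0 T)).prod (volume.restrict Ω))
  symm : ∀ i j, ∀ᵐ p ∂((volume.restrict (Ioo 0 T)).prod (volume.restrict Ω)),
    a i j p.1 p.2 = a j i p.1 p.2
  elliptic : ∀ᵐ p ∂((volume.restrict (Ioo 0 T)).prod (volume.restrict Ω)),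
    ∀ ξ : EuclideanSpace ℝ (Fin d), α * ‖ξ‖ ^ 2 ≤ ∑ i, ∑ j, a i j p.1 p.2 * ξ i * ξ j
  continuousOn : ∀ i j, ∀ᵐ x ∂(volume.restrict Ω), ContinuousOn (fun t => a i j t x) (Icc 0 T)
  modulus : ∀ i j, ∀ t₁ ∈ Icc 0 T, ∀ t₂ ∈ Icc 0 T, ∀ᵐ x ∂(volume.restrict Ω),
    |a i j t₁ x - a i j t₂ x| ≤ ω |t₁ - t₂|

/-- The bilinear form `a(t; u, v) = ⟨A(t) u, v⟩ = ∫_Ω ∑_{i,j} a_ij(t,x) ∂_i u(x) ∂_j v(x) dx`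
on `H¹₀(Ω)`. -/
def form {d : ℕ} {Ω : Set (EuclideanSpace ℝ (Fin d))}
    (a : Fin d → Fin d → ℝ → EuclideanSpace ℝ (Fin d) → ℝ) (t : ℝ) (u v : H10 Ω) : ℝ :=
  ∫ x in Ω, ∑ i, ∑ j, a i j t x * weakGrad u x i * weakGrad v x j

/-- A partition `0 = t_0 < t_1 < ⋯ < t_M = T`. Only `node m` with `m ≤ M` matters. -/
structure TimeMesh (T : ℝ) where
  M : ℕ
  M_pos : 0 < M
  node : ℕ → ℝ
  node_zero : node 0 = 0
  node_last : node M = T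
  node_lt : ∀ m < M, node m < node (m + 1)

namespace TimeMesh

variable {T : ℝ} (τ : TimeMesh T)

/-- The length `t_{m+1} - t_m` of the subinterval `(t_m, t_{m+1}]`. -/
def step (m : ℕ) : ℝ := τ.node (m + 1) - τ.node m

/-- The maximal time step `k`. -/
def kmax : ℝ :=
  (Finset.range τ.M).sup' (Finset.nonempty_range_iff.mpr τ.M_pos.ne') τ.step

/-- The minimal time step `k_min`. -/
def kmin : ℝ :=
  (Finset.range τ.M).inf' (Finset.nonempty_range_iff.mpr τ.M_pos.ne') τ.step

/-- The conditions on the mesh: `k_min ≥ c k^β`, ratios of neighbouring steps in `[κ⁻¹, κ]`,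
and `k ≤ T/4`. -/
structure IsAdmissible (c β κ : ℝ) : Prop where
  le_kmin : c * τ.kmax ^ β ≤ τ.kmin
  ratio : ∀ m, m + 1 < τ.M →
    κ⁻¹ ≤ τ.step m / τ.step (m + 1) ∧ τ.step m / τ.step (m + 1) ≤ κ
  kmax_le : τ.kmax ≤ T / 4

/-- The semidiscrete space `X_k^0` of functions of time with values in `H¹₀(Ω)` that are constant
on each `(t_m, t_{m+1}]`. The value on that subinterval is `v (t_{m+1})`. -/
def dG0Space {d : ℕ} (Ω : Set (EuclideanSpace ℝ (Fin d))) : Submodule ℝ (ℝ → H10 Ω) where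
  carrier := {v | ∀ m < τ.M, ∀ t ∈ Ioc (τ.node m) (τ.node (m + 1)), v t = v (τ.node (m + 1))}
  add_mem' := by
    intro v w hv hw m hm t ht
    simp only [Pi.add_apply, hv m hm t ht, hw m hm t ht]
  zero_mem' := by
    intro m _ t _
    rfl
  smul_mem' := by
    intro r v hv m hm t ht
    simp only [Pi.smul_apply, hv m hm t ht]

/-- The discontinuous Galerkin form on `X_k^0`:
`B(v,φ) = ∑_{i,j} (a_ij ∂_i v, ∂_j φ)_{I×Ω} + ∑_{m=1}^{M-1} ([v]_m, φ_m^+)_Ω + (v_0^+, φ_0^+)_Ω`;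
the terms with `∂_t v` vanish as `v` is constant on each subinterval. -/
def dGForm {d : ℕ} {Ω : Set (EuclideanSpace ℝ (Fin d))}
    (a : Fin d → Fin d → ℝ → EuclideanSpace ℝ (Fin d) → ℝ) (v φ : ℝ → H10 Ω) : ℝ :=
  (∫ t in Ioc 0 T, form a t (v t) (φ t))
    + ∑ m ∈ Finset.Ico 1 τ.M,
        ⟪toL2 (v (τ.node (m + 1))) - toL2 (v (τ.node m)), toL2 (φ (τ.node (m + 1)))⟫
    + ⟪toL2 (v (τ.node 1)), toL2 (φ (τ.node 1))⟫

/-- `u` is the dG(0) semidiscrete solution with right-hand side `f` and initial value `u₀`: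
`u ∈ X_k^0` and `B(u,φ) = (f,φ)_{I×Ω} + (u₀, φ_0^+)_Ω` for all `φ ∈ X_k^0`. -/
def IsDG0Solution {d : ℕ} {Ω : Set (EuclideanSpace ℝ (Fin d))}
    (a : Fin d → Fin d → ℝ → EuclideanSpace ℝ (Fin d) → ℝ) (f : ℝ → L2 Ω) (u₀ : L2 Ω)
    (u : ℝ → H10 Ω) : Prop :=
  u ∈ τ.dG0Space Ω ∧ ∀ φ ∈ τ.dG0Space Ω,
    τ.dGForm a u φ = (∫ t in Ioc 0 T, ⟪f t, toL2 (φ t)⟫) + ⟪u₀, toL2 (φ (τ.node 1))⟫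

/-- The functional `v ↦ ⟨A_k u, v⟩` in `H⁻¹(Ω)`, where `A_k` is the average of `A(t)` over
`(t_m, t_{m+1}]`. -/
def avgOp {d : ℕ} {Ω : Set (EuclideanSpace ℝ (Fin d))}
    (a : Fin d → Fin d → ℝ → EuclideanSpace ℝ (Fin d) → ℝ) (m : ℕ) (u v : H10 Ω) : ℝ :=
  (τ.step m)⁻¹ * ∫ t in Ioc (τ.node m) (τ.node (m + 1)), form a t u v

/-- The jump `[u]_m = u_m^+ - u_m^-` at `t_m`, for `0 ≤ m < M`, with `u_0^- = u₀`. -/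
def jump {d : ℕ} {Ω : Set (EuclideanSpace ℝ (Fin d))} (u₀ : L2 Ω) (u : ℝ → H10 Ω) (m : ℕ) :
    L2 Ω :=
  toL2 (u (τ.node (m + 1))) - if m = 0 then u₀ else toL2 (u (τ.node m))

end TimeMesh

end DGParabolic

end

/-! Testing with functions supported in one subinterval turns dG(0) into implicit Euler with
averaged forms `A m`. The vector `w n`, representing `A n (U n)` in `L²`, is the residual of the
Euler equation divided by the step, so its membership in `L²` is immediate. Only its size needs
work.

Fix `n`, freeze the form at `A n`, and run Euler steps backward in time starting from `w n` itself.
Summation by parts along this dual chain expresses `‖w n‖²` through the initial value, the data `F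
l` and the defects `(A n - A l)(U l, q)`. Parabolic smoothing of the chain (`EulerChain.energy`) at
distance `s = t (n+1) - t l` gives decay `s⁻¹` for the factors paired with the data, and `s^(-3/2)`
for the gradient in the defect. After division by `‖w n‖` this is `norm_operator_le`.

Multiply by the step and sum over `n`. The weights `s⁻¹` sum to a logarithm (`sum_step_div_le_log`),
and the weights `ω(s) s^(-3/2)` to at most their integral (`sum_step_mul_le_integral`). What remains
of the defect is the `L¹` in time norm of the gradient of the solution, which the `L²` energy
estimate controls by the data. No term has to be absorbed on the left. The jumps follow from the
Euler equation and the triangle inequality. -/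

namespace DGParabolic

/-! ### Smoothing estimates for implicit Euler with a fixed symmetric form. -/

section Chain

variable {V H : Type*} [AddCommGroup V] [Module ℝ V] [NormedAddCommGroup H] [InnerProductSpace ℝ H]

/-- Backward Euler steps of lengths `k 0, k 1, …` for `∂ₜ z + A z = 0`, `z(0) = ψ`, where `A` is the
operator of the form `b`. The values are `p j`, and `y j = A (p j)`; from the second step on,
`y (j + 1)` is the image of `q j`. -/
structure EulerChain (ι : V →ₗ[ℝ] H) (b : LinearMap.BilinForm ℝ V) (k : ℕ → ℝ) (ψ : H) where
  p : ℕ → V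
  y : ℕ → H
  q : ℕ → V
  start : ψ = ι (p 0) + k 0 • y 0
  step : ∀ j, p j = p (j + 1) + k (j + 1) • q j
  map_q : ∀ j, ι (q j) = y (j + 1)
  form_p : ∀ j φ, b (p j) φ = ⟪y j, ι φ⟫

/-- Each step solves one resolvent problem, and dividing its weak equation by the step length
identifies `y`. The start `ψ` lies only in `H`, so `y 0` need not come from `V`; this is why `q`
begins one step later. -/
theorem EulerChain.nonempty {ι : V →ₗ[ℝ] H} {b : LinearMap.BilinForm ℝ V}
    (hres : ∀ k : ℝ, 0 < k → ∀ h : H, ∃ z : V, ∀ φ, ⟪ι z, ι φ⟫ + k * b z φ = ⟪h, ι φ⟫)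
    {k : ℕ → ℝ} (hk : ∀ i, 0 < k i) (ψ : H) : Nonempty (EulerChain ι b k ψ) := by
  choose R hR using hres
  let p : ℕ → V := fun j => Nat.rec (R (k 0) (hk 0) ψ) (fun j z => R (k (j + 1)) (hk _) (ι z)) j
  let q : ℕ → V := fun j => (k (j + 1))⁻¹ • (p j - p (j + 1))
  have key : ∀ (c : ℝ) (hc : 0 < c) (h : H) (φ : V),
      b (R c hc h) φ = ⟪c⁻¹ • (h - ι (R c hc h)), ι φ⟫ := by
    intro c hc h φ
    have h1 := hR c hc h φ
    rw [real_inner_smul_left, inner_sub_left, ← h1]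
    field_simp
    ring
  refine ⟨⟨p, fun j => Nat.casesOn j ((k 0)⁻¹ • (ψ - ι (p 0))) fun j => ι (q j), q, ?_, ?_, ?_, ?_⟩⟩
  · simp [smul_smul, (hk 0).ne']
  · intro j
    simp [q, smul_smul, (hk (j + 1)).ne']
  · intro j; rfl
  · intro j φ
    cases j with
    | zero => exact key _ (hk 0) ψ φ
    | succ j =>
      have := key _ (hk (j + 1)) (ι (p j)) φ
      simp only [q, map_smul, map_sub]
      exact this

namespace EulerChain

variable {ι : V →ₗ[ℝ] H} {b : LinearMap.BilinForm ℝ V} {k : ℕ → ℝ} {ψ : H}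

theorem form_q (z : EulerChain ι b k ψ) (j : ℕ) (φ : V) :
    k (j + 1) * b (z.q j) φ = ⟪z.y j - z.y (j + 1), ι φ⟫ := by
  have h := z.form_p j φ
  rw [z.step j, map_add, map_smul, LinearMap.add_apply, LinearMap.smul_apply, z.form_p,
    smul_eq_mul] at h
  rw [inner_sub_left]
  linarith

theorem form_p_self (z : EulerChain ι b k ψ) (hb : ∀ u v, b u v = b v u) (j : ℕ) :
    b (z.p j) (z.p j) = b (z.p (j + 1)) (z.p (j + 1)) + 2 * k (j + 1) * ‖z.y (j + 1)‖ ^ 2 +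
      k (j + 1) ^ 2 * b (z.q j) (z.q j) := by
  have h := z.form_p (j + 1) (z.q j)
  rw [z.map_q, real_inner_self_eq_norm_sq] at h
  rw [z.step j, ← h]
  simp only [map_add, map_smul, LinearMap.add_apply, LinearMap.smul_apply, smul_eq_mul,
    hb (z.q j) (z.p (j + 1))]
  ring

theorem norm_add_sq_of_form (z : EulerChain ι b k ψ) (c : ℝ) (j : ℕ) :
    ‖ι (z.p j) + c • z.y j‖ ^ 2 =
      ‖ι (z.p j)‖ ^ 2 + 2 * c * b (z.p j) (z.p j) + c ^ 2 * ‖z.y j‖ ^ 2 := by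
  rw [norm_add_sq_real, z.form_p, real_inner_smul_right, norm_smul, real_inner_comm, mul_pow,
    Real.norm_eq_abs, sq_abs]
  ring

theorem norm_p_sq (z : EulerChain ι b k ψ) (j : ℕ) :
    ‖ι (z.p j)‖ ^ 2 = ‖ι (z.p (j + 1))‖ ^ 2 + 2 * k (j + 1) * b (z.p (j + 1)) (z.p (j + 1)) +
      k (j + 1) ^ 2 * ‖z.y (j + 1)‖ ^ 2 := by
  rw [z.step j, map_add, map_smul, z.map_q, norm_add_sq_of_form]

/-- Test the equation for `q j` with `q j` itself, expand the square of `y j = (y j - y (j + 1)) + y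
(j + 1)`, and drop the square of the difference. -/
theorem norm_y_sq (z : EulerChain ι b k ψ) (j : ℕ) :
    ‖z.y (j + 1)‖ ^ 2 + 2 * k (j + 1) * b (z.q j) (z.q j) ≤ ‖z.y j‖ ^ 2 := by
  have h := z.form_q j (z.q j)
  rw [z.map_q] at h
  have h2 := norm_add_sq_real (z.y j - z.y (j + 1)) (z.y (j + 1))
  rw [sub_add_cancel] at h2
  nlinarith [sq_nonneg ‖z.y j - z.y (j + 1)‖]

/-- Testing with `q j - q (j + 1)` produces a square, so `b (q (j+1)) (q j)` dominates `b (q (j+1))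
(q (j+1))`; positivity of `b` on the difference does the rest. -/
theorem form_q_self_anti (z : EulerChain ι b k ψ) (hb : ∀ u v, b u v = b v u)
    (hb0 : ∀ u, 0 ≤ b u u) (hk : ∀ i, 0 < k i) (j : ℕ) :
    b (z.q (j + 1)) (z.q (j + 1)) ≤ b (z.q j) (z.q j) := by
  have h := z.form_q (j + 1) (z.q j - z.q (j + 1))
  rw [map_sub ι, z.map_q, z.map_q, real_inner_self_eq_norm_sq] at h
  have h1 : 0 ≤ b (z.q (j + 1)) (z.q j - z.q (j + 1)) := by
    refine (mul_nonneg_iff_of_pos_left (hk (j + 1 + 1))).mp ?_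
    rw [h]; positivity
  have h2 := hb0 (z.q j - z.q (j + 1))
  simp only [map_sub, LinearMap.sub_apply] at h1 h2
  rw [hb (z.q j) (z.q (j + 1))] at h2
  linarith

/-- The left side is a Lyapunov functional: with `S` the elapsed time, growth of the weights `S`,
`S²`, `S³` is paid by the dissipation in the terms of lower weight. The last coefficient is chosen
small enough for bounded step ratios to close the `S³` term. -/
theorem energy (z : EulerChain ι b k ψ) (hb : ∀ u v, b u v = b v u)
    (hb0 : ∀ u, 0 ≤ b u u) (hk : ∀ i, 0 < k i) {κ : ℝ} (hκ : 0 < κ)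
    (hk1 : ∀ i, k i ≤ κ * k (i + 1)) (hk2 : ∀ i, k (i + 1) ≤ κ * k i) (j : ℕ) :
    ‖ι (z.p (j + 1))‖ ^ 2 + 2 * (∑ i ∈ Finset.range (j + 2), k i) * b (z.p (j + 1)) (z.p (j + 1))
      + (∑ i ∈ Finset.range (j + 2), k i) ^ 2 * ‖z.y (j + 1)‖ ^ 2
      + 2 / (3 * (1 + κ) ^ 2) * (∑ i ∈ Finset.range (j + 2), k i) ^ 3 * b (z.q j) (z.q j)
      ≤ ‖ψ‖ ^ 2 := by
  have hc : 2 / (3 * (1 + κ) ^ 2) * (1 + κ) ^ 2 = 2 / 3 := by field_simp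
  set c := 2 / (3 * (1 + κ) ^ 2) with hcdef
  have hc0 : 0 < c := by positivity
  induction j with
  | zero =>
    have e0 := z.norm_add_sq_of_form (k 0) 0
    rw [← z.start] at e0
    have e1 := z.norm_p_sq 0
    have e2 := z.form_p_self hb 0
    have e3 := z.norm_y_sq 0
    have p0 := hk 0
    have p1 := hk 1
    have q0 := hb0 (z.q 0)
    have e3' := mul_le_mul_of_nonneg_left e3 (sq_nonneg (k 0))
    simp only [Finset.sum_range_succ, Finset.sum_range_zero, zero_add] at *
    -- The dissipation of the first two steps carries the factor `k 0 * k 1`, so comparing it with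
    -- `(k 0 + k 1) ^ 2` needs the ratio bound in both directions. Later steps need only one.
    have hS0 : k 0 + k 1 ≤ (1 + κ) * k 0 := by nlinarith [hk2 0]
    have hS1 : k 0 + k 1 ≤ (1 + κ) * k 1 := by nlinarith [hk1 0]
    have hS : (k 0 + k 1) ^ 2 ≤ (1 + κ) ^ 2 * (k 0 * k 1) := by
      calc (k 0 + k 1) ^ 2 = (k 0 + k 1) * (k 0 + k 1) := sq _
        _ ≤ ((1 + κ) * k 0) * ((1 + κ) * k 1) := mul_le_mul hS0 hS1 (by positivity) (by positivity)
        _ = _ := by ring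
    have hS3 : c * (k 0 + k 1) ^ 3 ≤ 2 * k 0 * k 1 * (k 0 + k 1) := by
      calc c * (k 0 + k 1) ^ 3 = c * (k 0 + k 1) * (k 0 + k 1) ^ 2 := by ring
        _ ≤ c * (k 0 + k 1) * ((1 + κ) ^ 2 * (k 0 * k 1)) := by gcongr
        _ = (c * (1 + κ) ^ 2) * (k 0 + k 1) * (k 0 * k 1) := by ring
        _ = 2 / 3 * ((k 0 + k 1) * (k 0 * k 1)) := by rw [hc]; ring
        _ ≤ 2 * k 0 * k 1 * (k 0 + k 1) := by
          have : 0 ≤ (k 0 + k 1) * (k 0 * k 1) := by positivity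
          nlinarith
    have hS4 := mul_le_mul_of_nonneg_right hS3 q0
    have : 0 ≤ k 0 * k 1 * ‖z.y 1‖ ^ 2 := by positivity
    rw [e0, e1, e2]
    linarith
  | succ j ih =>
    rw [Finset.sum_range_succ (n := j + 2)]
    have hSk : k (j + 1) ≤ ∑ i ∈ Finset.range (j + 2), k i :=
      Finset.single_le_sum (f := k) (fun i _ => (hk i).le) (Finset.mem_range.mpr (by omega))
    have hk2' := hk2 (j + 1)
    have pk := hk (j + 2)
    have pk1 := hk (j + 1)
    set S := ∑ i ∈ Finset.range (j + 2), k i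
    have e1 := z.norm_p_sq (j + 1)
    have e2 := z.form_p_self hb (j + 1)
    have e3 := z.norm_y_sq (j + 1)
    have e4 := z.form_q_self_anti hb hb0 hk j
    simp only [add_assoc, Nat.reduceAdd] at *
    set k' := k (j + 2)
    have hS : 0 < S := by linarith
    have hS1 : S + k' ≤ (1 + κ) * S := by nlinarith
    have e3' := mul_le_mul_of_nonneg_left e3 (sq_nonneg S)
    have e4' := mul_le_mul_of_nonneg_left e4 (show 0 ≤ c * S ^ 3 by positivity)
    -- The dissipation available for `b (q (j+1)) (q (j+1))` is `2 k' S² + 2 k'² S`; it must cover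
    -- the increment of `c S³`, which is at most `3 c k' (S + k')²`.
    have hS3 : c * (S + k') ^ 3 ≤ c * S ^ 3 + 2 * k' * S * (S + k') := by
      have h1 : c * (S + k') ^ 2 ≤ 2 / 3 * (S * S) := by
        calc c * (S + k') ^ 2 ≤ c * ((1 + κ) * S) ^ 2 := by gcongr
          _ = (c * (1 + κ) ^ 2) * (S * S) := by ring
          _ = _ := by rw [hc]
      have h2 : (S + k') ^ 3 ≤ S ^ 3 + 3 * k' * (S + k') ^ 2 := by
        have : 0 ≤ k' ^ 2 * S := by positivity
        have : 0 ≤ k' ^ 3 := by positivity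
        nlinarith
      have h3 := mul_le_mul_of_nonneg_left h2 hc0.le
      have h4 := mul_le_mul_of_nonneg_left h1 (show 0 ≤ 3 * k' by positivity)
      have : 0 ≤ k' * S * k' := by positivity
      nlinarith
    have hS4 := mul_le_mul_of_nonneg_right hS3 (hb0 (z.q (j + 1)))
    have : 0 ≤ S * k' * ‖z.y (j + 2)‖ ^ 2 := by positivity
    refine le_trans ?_ ih
    rw [e1, e2]
    linarith

theorem sum_mul_norm_y_le (z : EulerChain ι b k ψ) (hb : ∀ u v, b u v = b v u)
    (hb0 : ∀ u, 0 ≤ b u u) (hk : ∀ i, 0 < k i) {κ : ℝ} (hκ : 0 < κ)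
    (hk1 : ∀ i, k i ≤ κ * k (i + 1)) (hk2 : ∀ i, k (i + 1) ≤ κ * k i) (j : ℕ) :
    (∑ i ∈ Finset.range (j + 1), k i) * ‖z.y j‖ ≤ ‖ψ‖ := by
  have hS : 0 ≤ ∑ i ∈ Finset.range (j + 1), k i := Finset.sum_nonneg fun i _ => (hk i).le
  refine le_of_sq_le_sq ?_ (norm_nonneg _)
  rw [mul_pow]
  cases j with
  | zero =>
    have e0 := z.norm_add_sq_of_form (k 0) 0
    rw [← z.start] at e0
    have := mul_nonneg (hk 0).le (hb0 (z.p 0))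
    simp only [zero_add, Finset.sum_range_one]
    nlinarith [sq_nonneg ‖ι (z.p 0)‖]
  | succ j =>
    have h := z.energy hb hb0 hk hκ hk1 hk2 j
    have h1 := mul_nonneg hS (hb0 (z.p (j + 1)))
    have h2 : 0 ≤ 2 / (3 * (1 + κ) ^ 2) * (∑ i ∈ Finset.range (j + 2), k i) ^ 3 *
      b (z.q j) (z.q j) := mul_nonneg (by positivity) (hb0 _)
    nlinarith [sq_nonneg ‖ι (z.p (j + 1))‖]

theorem form_q_self_le (z : EulerChain ι b k ψ) (hb : ∀ u v, b u v = b v u)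
    (hb0 : ∀ u, 0 ≤ b u u) (hk : ∀ i, 0 < k i) {κ : ℝ} (hκ : 0 < κ)
    (hk1 : ∀ i, k i ≤ κ * k (i + 1)) (hk2 : ∀ i, k (i + 1) ≤ κ * k i) (j : ℕ) :
    2 / (3 * (1 + κ) ^ 2) * (∑ i ∈ Finset.range (j + 2), k i) ^ 3 * b (z.q j) (z.q j)
      ≤ ‖ψ‖ ^ 2 := by
  have hS : 0 ≤ ∑ i ∈ Finset.range (j + 2), k i := Finset.sum_nonneg fun i _ => (hk i).le
  have h := z.energy hb hb0 hk hκ hk1 hk2 j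
  have h1 := mul_nonneg hS (hb0 (z.p (j + 1)))
  nlinarith [sq_nonneg ‖ι (z.p (j + 1))‖,
    mul_nonneg (sq_nonneg (∑ i ∈ Finset.range (j + 2), k i)) (sq_nonneg ‖z.y (j + 1)‖)]

end EulerChain

end Chain

/-! ### Sums over the mesh of the smoothing weights. -/

section Sums

/-- The term `n = l` is 1. Every later term has the form `1 - x ≤ -log x`, with `x` a ratio of
consecutive distances to `t l`, so the logarithms telescope. -/
theorem sum_step_div_le_log {t : ℕ → ℝ} {l N : ℕ} (hlN : l < N)
    (ht : ∀ m < N, t m < t (m + 1)) :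
    ∑ n ∈ Finset.Ico l N, (t (n + 1) - t n) / (t (n + 1) - t l) ≤
      1 + Real.log ((t N - t l) / (t (l + 1) - t l)) := by
  have h : ∀ N', l + 1 ≤ N' → N' ≤ N → 0 < t N' - t l ∧
      ∑ n ∈ Finset.Ico l N', (t (n + 1) - t n) / (t (n + 1) - t l) ≤
      1 + Real.log ((t N' - t l) / (t (l + 1) - t l)) := by
    intro N' h1
    have h0 : 0 < t (l + 1) - t l := by linarith [ht l hlN]
    induction N', h1 using Nat.le_induction with
    | base => intro _; simp [h0.ne', sub_pos.mp h0]
    | succ m hm ih =>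
      intro h2
      obtain ⟨p, ih⟩ := ih (by omega)
      have hlt := ht m (by omega)
      have p' : 0 < t (m + 1) - t l := by linarith
      refine ⟨p', ?_⟩
      rw [Finset.sum_Ico_succ_top (by omega)]
      have h3 := Real.log_le_sub_one_of_pos (div_pos p p')
      rw [Real.log_div p.ne' p'.ne'] at h3
      rw [Real.log_div p'.ne' h0.ne']
      rw [Real.log_div p.ne' h0.ne'] at ih
      have h4 : (t (m + 1) - t m) / (t (m + 1) - t l)
          = 1 - (t m - t l) / (t (m + 1) - t l) := by
        field_simp; ring
      linarith
  exact (h N hlN le_rfl).2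

/-- Right-endpoint sums of a decreasing function lie below its integral; sampling on the right
avoids the possible singularity at 0. -/
theorem sum_step_mul_le_integral {t : ℕ → ℝ} {l N : ℕ} (hlN : l ≤ N)
    (ht : ∀ m < N, t m < t (m + 1)) {T : ℝ} (hT : t N - t l ≤ T) {G : ℝ → ℝ}
    (hG : AntitoneOn G (Ioc 0 T)) (hGi : IntegrableOn G (Ioc 0 T)) (hG0 : ∀ s ∈ Ioc 0 T, 0 ≤ G s) :
    ∑ n ∈ Finset.Ico l N, (t (n + 1) - t n) * G (t (n + 1) - t l) ≤ ∫ s in Ioc 0 T, G s := by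
  have h : ∀ N', l ≤ N' → N' ≤ N → t N' - t l ≤ T → 0 ≤ t N' - t l ∧
      ∑ n ∈ Finset.Ico l N', (t (n + 1) - t n) * G (t (n + 1) - t l) ≤
        ∫ s in Ioc 0 (t N' - t l), G s := by
    intro N' h1
    induction N', h1 using Nat.le_induction with
    | base => simp
    | succ m hm ih =>
      intro h2 h3
      have hlt := ht m (by omega)
      obtain ⟨p, ih⟩ := ih (by omega) (by linarith)
      refine ⟨by linarith, ?_⟩
      have hsub : Ioc (t m - t l) (t (m + 1) - t l) ⊆ Ioc 0 T := Ioc_subset_Ioc p h3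
      rw [Finset.sum_Ico_succ_top hm, ← Ioc_union_Ioc_eq_Ioc p (by linarith),
        setIntegral_union (Ioc_disjoint_Ioc_of_le le_rfl) measurableSet_Ioc
          (hGi.mono_set (Ioc_subset_Ioc_right (by linarith))) (hGi.mono_set hsub)]
      have h4 : ∫ _ in Ioc (t m - t l) (t (m + 1) - t l), G (t (m + 1) - t l) ≤
          ∫ s in Ioc (t m - t l) (t (m + 1) - t l), G s :=
        setIntegral_mono_on (integrableOn_const (by simp)) (hGi.mono_set hsub)
          measurableSet_Ioc fun s hs => hG (hsub hs) (hsub ⟨by linarith, le_rfl⟩) hs.2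
      rw [setIntegral_const, smul_eq_mul, Real.volume_real_Ioc_of_le (by linarith)] at h4
      linarith
  refine (h N hlN le_rfl hT).2.trans (setIntegral_mono_set hGi ?_
    (Ioc_subset_Ioc_right hT).eventuallyLE)
  filter_upwards [ae_restrict_mem measurableSet_Ioc] with s hs using hG0 s hs

end Sums

/-! ### Implicit Euler with time-dependent forms: energy and pointwise duality bounds. -/

section Euler

variable {V H : Type*} [AddCommGroup V] [Module ℝ V] [NormedAddCommGroup H] [InnerProductSpace ℝ H]
  {ι : V →ₗ[ℝ] H} {A : ℕ → LinearMap.BilinForm ℝ V} {g : V → ℝ} {t : ℕ → ℝ}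
  {U : ℕ → V} {F P : ℕ → H} {α : ℝ}

/-- Energy estimate for the implicit Euler method with an `ℓ¹` right-hand side. -/
theorem energy_estimate (hα : 0 < α) {M : ℕ} (ht : ∀ m < M, t m < t (m + 1))
    (hcoer : ∀ m < M, ∀ u, α * g u ^ 2 ≤ A m u u) (hP : ∀ m, P (m + 1) = ι (U m))
    (heq : ∀ m < M, ∀ φ,
      ⟪ι (U m) - P m, ι φ⟫ + (t (m + 1) - t m) * A m (U m) φ = ⟪F m, ι φ⟫) :
    2 * α * ∑ l ∈ Finset.range M, (t (l + 1) - t l) * g (U l) ^ 2 ≤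
      3 * (‖P 0‖ + ∑ l ∈ Finset.range M, ‖F l‖) ^ 2 := by
  set D := ‖P 0‖ + ∑ l ∈ Finset.range M, ‖F l‖ with hD
  -- The uniform bound on `‖P m‖` is carried along so that each pairing of `F m` with the solution
  -- costs only `D * ‖F m‖`. The final factor 3 comes from `‖P 0‖ ^ 2 + 2 * D ^ 2`.
  have h : ∀ m ≤ M, ‖P m‖ ≤ ‖P 0‖ + ∑ l ∈ Finset.range m, ‖F l‖ ∧
      ‖P m‖ ^ 2 + 2 * α * ∑ l ∈ Finset.range m, (t (l + 1) - t l) * g (U l) ^ 2 ≤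
        ‖P 0‖ ^ 2 + 2 * D * ∑ l ∈ Finset.range m, ‖F l‖ := by
    intro m
    induction m with
    | zero => simp
    | succ m ih =>
      intro hm
      obtain ⟨ih1, ih2⟩ := ih (by omega)
      have hk : 0 < t (m + 1) - t m := by linarith [ht m hm]
      have e := heq m hm (U m)
      have hc := mul_le_mul_of_nonneg_left (hcoer m hm (U m)) hk.le
      rw [← hP m] at e
      rw [Finset.sum_range_succ, Finset.sum_range_succ]
      rw [inner_sub_left, real_inner_self_eq_norm_sq] at e
      have h1 := real_inner_le_norm (F m) (P (m + 1))
      have h2 := real_inner_le_norm (P m) (P (m + 1))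
      have hg : 0 ≤ (t (m + 1) - t m) * (α * g (U m) ^ 2) := by positivity
      have h3 : ‖P (m + 1)‖ ≤ ‖P m‖ + ‖F m‖ := by
        by_contra! hcon
        have : 0 < ‖P (m + 1)‖ := by linarith [norm_nonneg (P m), norm_nonneg (F m)]
        nlinarith
      refine ⟨by linarith, ?_⟩
      have h4 : ‖P (m + 1)‖ ≤ D := by
        have : ∑ l ∈ Finset.range (m + 1), ‖F l‖ ≤ ∑ l ∈ Finset.range M, ‖F l‖ :=
          Finset.sum_le_sum_of_subset_of_nonneg (Finset.range_mono hm) fun _ _ _ => norm_nonneg _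
        rw [Finset.sum_range_succ] at this
        linarith
      have h5 := mul_le_mul_of_nonneg_left h4 (norm_nonneg (F m))
      nlinarith [sq_nonneg (‖P (m + 1)‖ - ‖P m‖)]
  have h1 := (h M le_rfl).2
  have hs : 0 ≤ ∑ l ∈ Finset.range M, ‖F l‖ := Finset.sum_nonneg fun _ _ => norm_nonneg _
  nlinarith [sq_nonneg ‖P M‖, norm_nonneg (P 0)]

/-- Pointwise bound for `A_n u_n`, by duality with the backward problem with frozen form `A n`. -/
theorem norm_operator_le {n : ℕ} (ht : ∀ m ≤ n, t m < t (m + 1)) {κ : ℝ} (hκ : 1 ≤ κ)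
    (hr1 : ∀ m < n, t (m + 1) - t m ≤ κ * (t (m + 2) - t (m + 1)))
    (hr2 : ∀ m < n, t (m + 2) - t (m + 1) ≤ κ * (t (m + 1) - t m))
    (hsymm : ∀ u v, A n u v = A n v u) (hα : 0 < α) (hcoer : ∀ u, α * g u ^ 2 ≤ A n u u)
    (hg : ∀ u, 0 ≤ g u)
    (hres : ∀ k : ℝ, 0 < k → ∀ h : H, ∃ z : V, ∀ φ, ⟪ι z, ι φ⟫ + k * A n z φ = ⟪h, ι φ⟫)
    {ρ : ℝ → ℝ} (hρ0 : ∀ l < n, 0 ≤ ρ (t (n + 1) - t l))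
    (hρ : ∀ l < n, ∀ u v, |A n u v - A l u v| ≤ ρ (t (n + 1) - t l) * g u * g v)
    (hP : ∀ m, P (m + 1) = ι (U m))
    (heq : ∀ m ≤ n, ∀ φ,
      ⟪ι (U m) - P m, ι φ⟫ + (t (m + 1) - t m) * A m (U m) φ = ⟪F m, ι φ⟫)
    {w : H} (hw : ∀ φ, A n (U n) φ = ⟪w, ι φ⟫)
    (hw' : (t (n + 1) - t n) • w + (ι (U n) - P n) = F n) :
    ‖w‖ ≤ ‖P 0‖ / (t (n + 1) - t 0) +
      (∑ l ∈ Finset.Ico 0 (n + 1), ‖F l‖ / (t (n + 1) - t l) +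
        √(3 * (1 + κ) ^ 2 / (2 * α)) * ∑ l ∈ Finset.Ico 0 n,
        (t (l + 1) - t l) * (ρ (t (n + 1) - t l) / (t (n + 1) - t l) ^ (3 / 2 : ℝ)) * g (U l)) := by
  set K := √(3 * (1 + κ) ^ 2 / (2 * α)) with hK
  have hK2 : K ^ 2 = 3 * (1 + κ) ^ 2 / (2 * α) := Real.sq_sqrt (by positivity)
  -- Steps in reversed order. Truncated subtraction repeats the first mesh step once `i > n`, so the
  -- chain is infinite with positive steps, and `1 ≤ κ` keeps the ratio bounds valid there.
  set k : ℕ → ℝ := fun i => t (n - i + 1) - t (n - i) with hkdef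
  have hk : ∀ i, 0 < k i := fun i => sub_pos.mpr (ht _ (by omega))
  have hki : ∀ i l, l + i = n → k i = t (l + 1) - t l := by
    intro i l h
    simp only [hkdef, show n - i = l by omega]
  have hk1 : ∀ i, k i ≤ κ * k (i + 1) := by
    intro i
    by_cases hi : i < n
    · rw [hki i (n - i) (by omega), hki (i + 1) (n - i - 1) (by omega),
        show n - i = n - i - 1 + 1 by omega]
      exact hr2 (n - i - 1) (by omega)
    · have : k (i + 1) = k i := by simp only [hkdef, show n - (i + 1) = n - i by omega]
      rw [this]; nlinarith [hk i]
  have hk2 : ∀ i, k (i + 1) ≤ κ * k i := by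
    intro i
    by_cases hi : i < n
    · rw [hki i (n - i) (by omega), hki (i + 1) (n - i - 1) (by omega),
        show n - i = n - i - 1 + 1 by omega]
      exact hr1 (n - i - 1) (by omega)
    · have : k (i + 1) = k i := by simp only [hkdef, show n - (i + 1) = n - i by omega]
      rw [this]; nlinarith [hk i]
  have hS : ∀ i l, l + i = n → ∑ j ∈ Finset.range (i + 1), k j = t (n + 1) - t l := by
    intro i
    induction i with
    | zero => intro l h; simp [hki 0 l h, show l = n by omega]
    | succ i ih =>
      intro l h
      rw [Finset.sum_range_succ, ih (l + 1) (by omega), hki (i + 1) l h]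
      ring
  have hSpos : ∀ l ≤ n, 0 < t (n + 1) - t l := by
    intro l hl
    rw [← hS (n - l) l (by omega)]
    exact Finset.sum_pos (fun i _ => hk i) ⟨0, by simp⟩
  have hb0 : ∀ u, 0 ≤ A n u u := fun u => le_trans (by positivity) (hcoer u)
  -- The dual chain starts at `w` itself, so the duality pairing yields `‖w‖ ^ 2`.
  obtain ⟨z⟩ := EulerChain.nonempty (ι := ι) (b := A n) hres hk w
  have hκ0 : 0 < κ := by linarith
  have hy : ∀ i l, l + i = n → ‖z.y i‖ ≤ ‖w‖ / (t (n + 1) - t l) := by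
    intro i l h
    rw [le_div_iff₀' (hSpos l (by omega)), ← hS i l h]
    exact z.sum_mul_norm_y_le hsymm hb0 hk hκ0 hk1 hk2 i
  have hq : ∀ i l, l + (i + 1) = n →
      g (z.q i) ≤ K * ‖w‖ / (t (n + 1) - t l) ^ (3 / 2 : ℝ) := by
    intro i l h
    have hs := hSpos l (by omega)
    have h1 := z.form_q_self_le hsymm hb0 hk hκ0 hk1 hk2 i
    rw [hS (i + 1) l h] at h1
    rw [le_div_iff₀ (by positivity)]
    refine le_of_sq_le_sq ?_ (by positivity)
    have h2 : ((t (n + 1) - t l) ^ (3 / 2 : ℝ)) ^ 2 = (t (n + 1) - t l) ^ 3 := by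
      rw [← Real.rpow_natCast, ← Real.rpow_mul hs.le, ← Real.rpow_natCast]
      norm_num
    rw [mul_pow, mul_pow, h2, hK2]
    have h3 := mul_le_mul_of_nonneg_left (hcoer (z.q i))
      (show 0 ≤ 2 / (3 * (1 + κ) ^ 2) * (t (n + 1) - t l) ^ 3 by positivity)
    calc g (z.q i) ^ 2 * (t (n + 1) - t l) ^ 3
        = 3 * (1 + κ) ^ 2 / (2 * α) *
          (2 / (3 * (1 + κ) ^ 2) * (t (n + 1) - t l) ^ 3 * (α * g (z.q i) ^ 2)) := by
          field_simp
      _ ≤ _ := by gcongr; exact h3.trans h1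
  have hF : ∀ i l, l + i = n → ⟪F l, z.y i⟫ ≤ ‖F l‖ / (t (n + 1) - t l) * ‖w‖ := by
    intro i l h
    calc _ ≤ ‖F l‖ * ‖z.y i‖ := real_inner_le_norm _ _
      _ ≤ ‖F l‖ * (‖w‖ / (t (n + 1) - t l)) := by gcongr; exact hy i l h
      _ = _ := by ring
  -- Induction backward in time: the pairing of the current solution value with the dual value is
  -- moved one mesh step to the left, leaving a data term and a defect term.
  have main : ∀ i l, l + i = n → ‖w‖ ^ 2 ≤ ⟪P l, z.y i⟫ +
      (∑ l ∈ Finset.Ico l (n + 1), ‖F l‖ / (t (n + 1) - t l) + K * ∑ l ∈ Finset.Ico l n,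
        (t (l + 1) - t l) * (ρ (t (n + 1) - t l) / (t (n + 1) - t l) ^ (3 / 2 : ℝ)) * g (U l))
        * ‖w‖ := by
    intro i
    induction i with
    | zero =>
      intro l h
      obtain rfl : l = n := by omega
      -- Insert the first dual step in one factor. By symmetry and the Euler equation at `n`, the
      -- two contributions of `U n` cancel, leaving only `P n` and `F n` against `y 0`.
      have e1 : ⟪w, w⟫ = ⟪w, ι (z.p 0)⟫ + ⟪k 0 • w, z.y 0⟫ := by
        nth_rewrite 2 [z.start]
        rw [inner_add_right, real_inner_smul_right, real_inner_smul_left]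
      rw [← hw, hsymm, z.form_p, hki 0 l h, eq_sub_of_add_eq hw', inner_sub_left,
        inner_sub_left, real_inner_self_eq_norm_sq, real_inner_comm] at e1
      have := hF 0 l h
      simp only [Nat.Ico_succ_singleton, Finset.sum_singleton, Finset.Ico_self, Finset.sum_empty,
        mul_zero, add_zero]
      linarith
    | succ i ih =>
      intro l h
      have hl : l < n := by omega
      have e := ih (l + 1) (by omega)
      -- The dual equation is tested with `U l` and the primal one with `q i`, which is admissible
      -- because it lies in `V`; the difference leaves `(A n - A l) (U l) (q i)`.
      have e1 := z.form_q i (U l)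
      rw [hki (i + 1) l h, inner_sub_left, real_inner_comm, real_inner_comm (ι (U l))] at e1
      have e2 := heq l hl.le (z.q i)
      rw [z.map_q, inner_sub_left] at e2
      have e3 := (abs_le.mp (hρ l hl (U l) (z.q i))).2
      have e4 := hF (i + 1) l h
      rw [hP l] at e
      rw [Finset.sum_eq_sum_Ico_succ_bot (by omega : l < n + 1),
        Finset.sum_eq_sum_Ico_succ_bot hl]
      have hkl : 0 < t (l + 1) - t l := sub_pos.mpr (ht l hl.le)
      have e5 : (t (l + 1) - t l) * (A n (U l) (z.q i) - A l (U l) (z.q i)) ≤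
          K * ((t (l + 1) - t l) *
            (ρ (t (n + 1) - t l) / (t (n + 1) - t l) ^ (3 / 2 : ℝ)) * g (U l)) * ‖w‖ := by
        calc _ ≤ (t (l + 1) - t l) * (ρ (t (n + 1) - t l) * g (U l) * g (z.q i)) := by gcongr
          _ ≤ (t (l + 1) - t l) * (ρ (t (n + 1) - t l) * g (U l) *
              (K * ‖w‖ / (t (n + 1) - t l) ^ (3 / 2 : ℝ))) := by
            have := mul_nonneg (hρ0 l hl) (hg (U l))
            gcongr
            exact hq i l h
          _ = _ := by ring
      rw [hsymm (z.q i)] at e1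
      linarith
  have h := main n 0 (by omega)
  have h1 : ⟪P 0, z.y n⟫ ≤ ‖P 0‖ / (t (n + 1) - t 0) * ‖w‖ := by
    calc _ ≤ ‖P 0‖ * ‖z.y n‖ := real_inner_le_norm _ _
      _ ≤ ‖P 0‖ * (‖w‖ / (t (n + 1) - t 0)) := by gcongr; exact hy n 0 (by omega)
      _ = _ := by ring
  rcases (norm_nonneg w).eq_or_lt with h0 | h0
  · rw [← h0]
    have := hSpos 0 (by omega)
    refine add_nonneg (by positivity) (add_nonneg (Finset.sum_nonneg fun l hl => ?_)
      (mul_nonneg (by positivity) (Finset.sum_nonneg fun l hl => ?_)))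
    · have := hSpos l (by simp at hl; omega)
      positivity
    · have hl' : l < n := by simpa using hl
      have := hSpos l hl'.le
      have := hρ0 l hl'
      have := hg (U l)
      have := sub_pos.mpr (ht l hl'.le)
      positivity
  · refine le_of_mul_le_mul_right ?_ h0
    rw [← sq, add_mul]
    linarith

end Euler

/-! ### Summation over time: the `ℓ¹` estimate. -/

section Euler

variable {V H : Type*} [AddCommGroup V] [Module ℝ V] [NormedAddCommGroup H] [InnerProductSpace ℝ H]
  {ι : V →ₗ[ℝ] H} {A : ℕ → LinearMap.BilinForm ℝ V} {g : V → ℝ} {t : ℕ → ℝ}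
  {U : ℕ → V} {F P : ℕ → H} {α : ℝ}

/-- Maximal regularity in `ℓ¹` for the implicit Euler method with a form depending on time, up to
a factor `L` that bounds `∑ (t (n+1) - t n) / (t (n+1) - t l)`. -/
theorem sum_step_mul_norm_operator_le {M : ℕ} (hM : 0 < M) (ht : ∀ m < M, t m < t (m + 1))
    {T : ℝ} (hT : ∀ l < M, t M - t l ≤ T) {κ : ℝ} (hκ : 1 ≤ κ)
    (hr1 : ∀ m, m + 1 < M → t (m + 1) - t m ≤ κ * (t (m + 2) - t (m + 1)))
    (hr2 : ∀ m, m + 1 < M → t (m + 2) - t (m + 1) ≤ κ * (t (m + 1) - t m))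
    (hsymm : ∀ m < M, ∀ u v, A m u v = A m v u) (hα : 0 < α)
    (hcoer : ∀ m < M, ∀ u, α * g u ^ 2 ≤ A m u u) (hg : ∀ u, 0 ≤ g u)
    (hres : ∀ m < M, ∀ k : ℝ, 0 < k → ∀ h : H, ∃ z : V, ∀ φ,
      ⟪ι z, ι φ⟫ + k * A m z φ = ⟪h, ι φ⟫)
    {ρ : ℝ → ℝ} (hρ0 : ∀ s ∈ Ioc 0 T, 0 ≤ ρ s)
    (hρa : AntitoneOn (fun s => ρ s / s ^ (3 / 2 : ℝ)) (Ioc 0 T))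
    (hρi : IntegrableOn (fun s => ρ s / s ^ (3 / 2 : ℝ)) (Ioc 0 T))
    (hρ : ∀ n < M, ∀ l < n, ∀ u v, |A n u v - A l u v| ≤ ρ (t (n + 1) - t l) * g u * g v)
    (hP : ∀ m, P (m + 1) = ι (U m))
    (heq : ∀ m < M, ∀ φ,
      ⟪ι (U m) - P m, ι φ⟫ + (t (m + 1) - t m) * A m (U m) φ = ⟪F m, ι φ⟫)
    {w : ℕ → H} (hw : ∀ m < M, ∀ φ, A m (U m) φ = ⟪w m, ι φ⟫)
    (hw' : ∀ m < M, (t (m + 1) - t m) • w m + (ι (U m) - P m) = F m)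
    {L : ℝ} (hL : ∀ l < M, 1 + Real.log ((t M - t l) / (t (l + 1) - t l)) ≤ L) :
    ∑ n ∈ Finset.range M, (t (n + 1) - t n) * ‖w n‖ ≤
      (L + √(3 * (1 + κ) ^ 2 / (2 * α)) * (∫ s in Ioc 0 T, ρ s / s ^ (3 / 2 : ℝ)) *
        √(3 * T / (2 * α))) * (‖P 0‖ + ∑ l ∈ Finset.range M, ‖F l‖) := by
  set K := √(3 * (1 + κ) ^ 2 / (2 * α))
  set J := ∫ s in Ioc 0 T, ρ s / s ^ (3 / 2 : ℝ)
  set D := ‖P 0‖ + ∑ l ∈ Finset.range M, ‖F l‖ with hD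
  have hD0 : 0 ≤ D := add_nonneg (norm_nonneg _) (Finset.sum_nonneg fun _ _ => norm_nonneg _)
  have hmono : ∀ l n, l ≤ n → n ≤ M → t l ≤ t n := by
    intro l n h
    induction n, h using Nat.le_induction with
    | base => intro _; rfl
    | succ m _ ih => intro h; exact (ih (by omega)).trans (ht m (by omega)).le
  have hT0 : 0 < T := by
    have := hmono 1 M hM le_rfl
    linarith [ht 0 hM, hT 0 hM]
  have hk : ∀ n < M, 0 < t (n + 1) - t n := fun n hn => sub_pos.mpr (ht n hn)
  have hmem : ∀ n < M, ∀ l ≤ n, t (n + 1) - t l ∈ Ioc 0 T := by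
    intro n hn l hl
    have h1 := hmono l n hl hn.le
    have h2 := hmono (n + 1) M hn le_rfl
    constructor <;> linarith [ht n hn, hT l (by omega)]
  have hG0 : ∀ s ∈ Ioc 0 T, 0 ≤ ρ s / s ^ (3 / 2 : ℝ) := fun s hs =>
    div_nonneg (hρ0 s hs) (Real.rpow_nonneg hs.1.le _)
  have hJ0 : 0 ≤ J := setIntegral_nonneg measurableSet_Ioc hG0
  have hpt : ∀ n ∈ Finset.range M, (t (n + 1) - t n) * ‖w n‖ ≤ (t (n + 1) - t n) *
      (‖P 0‖ / (t (n + 1) - t 0) + (∑ l ∈ Finset.Ico 0 (n + 1), ‖F l‖ / (t (n + 1) - t l) +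
        K * ∑ l ∈ Finset.Ico 0 n,
        (t (l + 1) - t l) * (ρ (t (n + 1) - t l) / (t (n + 1) - t l) ^ (3 / 2 : ℝ)) *
          g (U l))) := by
    intro n hn
    have hn : n < M := Finset.mem_range.mp hn
    refine mul_le_mul_of_nonneg_left ?_ (hk n hn).le
    exact norm_operator_le (fun m hm => ht m (by omega)) hκ (fun m hm => hr1 m (by omega))
      (fun m hm => hr2 m (by omega)) (hsymm n hn) hα (hcoer n hn) hg (hres n hn)
      (fun l hl => hρ0 _ (hmem n hn l hl.le)) (hρ n hn) hP (fun m hm => heq m (by omega))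
      (hw n hn) (hw' n hn)
  refine (Finset.sum_le_sum hpt).trans ?_
  have hlog : ∀ l < M, ∑ n ∈ Finset.Ico l M, (t (n + 1) - t n) / (t (n + 1) - t l) ≤ L :=
    fun l hl => (sum_step_div_le_log hl ht).trans (hL l hl)
  have h1 : ∑ n ∈ Finset.range M, (t (n + 1) - t n) * (‖P 0‖ / (t (n + 1) - t 0)) ≤
      L * ‖P 0‖ := by
    calc _ = (∑ n ∈ Finset.Ico 0 M, (t (n + 1) - t n) / (t (n + 1) - t 0)) * ‖P 0‖ := by
          rw [← Finset.range_eq_Ico, Finset.sum_mul]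
          exact Finset.sum_congr rfl fun _ _ => by ring
      _ ≤ _ := by gcongr; exact hlog 0 hM
  have h2 : ∑ n ∈ Finset.range M, (t (n + 1) - t n) *
      ∑ l ∈ Finset.Ico 0 (n + 1), ‖F l‖ / (t (n + 1) - t l) ≤
      L * ∑ l ∈ Finset.range M, ‖F l‖ := by
    calc _ = ∑ n ∈ Finset.Ico 0 M, ∑ l ∈ Finset.Ico 0 (n + 1),
            ‖F l‖ * ((t (n + 1) - t n) / (t (n + 1) - t l)) := by
          rw [← Finset.range_eq_Ico]
          refine Finset.sum_congr rfl fun _ _ => ?_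
          rw [Finset.mul_sum]
          exact Finset.sum_congr rfl fun _ _ => by ring
      _ = ∑ l ∈ Finset.range M, ‖F l‖ *
            ∑ n ∈ Finset.Ico l M, (t (n + 1) - t n) / (t (n + 1) - t l) := by
          rw [← Finset.sum_Ico_Ico_comm, Finset.range_eq_Ico]
          exact Finset.sum_congr rfl fun _ _ => by rw [Finset.mul_sum]
      _ ≤ ∑ l ∈ Finset.range M, ‖F l‖ * L := by
          refine Finset.sum_le_sum fun l hl => ?_
          gcongr
          exact hlog l (Finset.mem_range.mp hl)
      _ = _ := by rw [← Finset.sum_mul, mul_comm]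
  have h3 : ∑ n ∈ Finset.range M, (t (n + 1) - t n) * ∑ l ∈ Finset.Ico 0 n,
        (t (l + 1) - t l) * (ρ (t (n + 1) - t l) / (t (n + 1) - t l) ^ (3 / 2 : ℝ)) * g (U l) ≤
      J * ∑ l ∈ Finset.range M, (t (l + 1) - t l) * g (U l) := by
    -- The nonnegative diagonal terms `l = n` are added so that the double sum runs over the full
    -- triangle and its order can be exchanged.
    calc _ ≤ ∑ n ∈ Finset.Ico 0 M, ∑ l ∈ Finset.Ico 0 (n + 1),
            (t (l + 1) - t l) * g (U l) * ((t (n + 1) - t n) *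
              (ρ (t (n + 1) - t l) / (t (n + 1) - t l) ^ (3 / 2 : ℝ))) := by
          rw [← Finset.range_eq_Ico]
          refine Finset.sum_le_sum fun n hn => ?_
          have hn : n < M := Finset.mem_range.mp hn
          rw [Finset.mul_sum]
          have : ∀ l ∈ Finset.Ico 0 (n + 1), 0 ≤ (t (l + 1) - t l) * g (U l) *
              ((t (n + 1) - t n) * (ρ (t (n + 1) - t l) / (t (n + 1) - t l) ^ (3 / 2 : ℝ))) := by
            intro l hl
            have hl : l ≤ n := by simp at hl; omega
            exact mul_nonneg (mul_nonneg (hk l (by omega)).le (hg _))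
              (mul_nonneg (hk n hn).le (hG0 _ (hmem n hn l hl)))
          refine le_trans (le_of_eq ?_) (Finset.sum_le_sum_of_subset_of_nonneg
            (Finset.Ico_subset_Ico_right (Nat.le_succ n)) fun l hl _ => this l hl)
          exact Finset.sum_congr rfl fun _ _ => by ring
      _ = ∑ l ∈ Finset.range M, (t (l + 1) - t l) * g (U l) *
            ∑ n ∈ Finset.Ico l M, (t (n + 1) - t n) *
              (ρ (t (n + 1) - t l) / (t (n + 1) - t l) ^ (3 / 2 : ℝ)) := by
          rw [← Finset.sum_Ico_Ico_comm, Finset.range_eq_Ico]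
          exact Finset.sum_congr rfl fun _ _ => by rw [Finset.mul_sum]
      _ ≤ ∑ l ∈ Finset.range M, (t (l + 1) - t l) * g (U l) * J := by
          refine Finset.sum_le_sum fun l hl => ?_
          have hl : l < M := Finset.mem_range.mp hl
          refine mul_le_mul_of_nonneg_left ?_ (mul_nonneg (hk l hl).le (hg _))
          exact sum_step_mul_le_integral hl.le ht (hT l hl) hρa hρi hG0
      _ = _ := by rw [← Finset.sum_mul, mul_comm]
  -- Cauchy–Schwarz in time with weights the step lengths, followed by the energy estimate.
  have h4 : ∑ l ∈ Finset.range M, (t (l + 1) - t l) * g (U l) ≤ √(3 * T / (2 * α)) * D := by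
    refine le_of_sq_le_sq ?_ (by positivity)
    have hcs := Finset.sum_sq_le_sum_mul_sum_of_sq_le_mul (Finset.range M)
      (r := fun l => (t (l + 1) - t l) * g (U l)) (f := fun l => t (l + 1) - t l)
      (g := fun l => (t (l + 1) - t l) * g (U l) ^ 2)
      (fun l hl => (hk l (Finset.mem_range.mp hl)).le)
      (fun l hl => mul_nonneg (hk l (Finset.mem_range.mp hl)).le (sq_nonneg _))
      (fun l _ => le_of_eq (by ring))
    have hen := energy_estimate hα ht hcoer hP heq
    rw [Finset.sum_range_sub] at hcs
    rw [mul_pow, Real.sq_sqrt (by positivity)]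
    have hE : 0 ≤ ∑ l ∈ Finset.range M, (t (l + 1) - t l) * g (U l) ^ 2 :=
      Finset.sum_nonneg fun l hl => mul_nonneg (hk l (Finset.mem_range.mp hl)).le (sq_nonneg _)
    calc _ ≤ _ := hcs
      _ ≤ T * ∑ l ∈ Finset.range M, (t (l + 1) - t l) * g (U l) ^ 2 := by
        gcongr; exact hT 0 hM
      _ ≤ T * (3 * D ^ 2 / (2 * α)) := by
        gcongr
        rw [le_div_iff₀' (by positivity)]
        exact hen
      _ = _ := by ring
  simp only [mul_add, Finset.sum_add_distrib]
  have h5 : ∑ n ∈ Finset.range M, (t (n + 1) - t n) * (K * ∑ l ∈ Finset.Ico 0 n,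
      (t (l + 1) - t l) * (ρ (t (n + 1) - t l) / (t (n + 1) - t l) ^ (3 / 2 : ℝ)) * g (U l)) ≤
      K * J * √(3 * T / (2 * α)) * D := by
    calc _ = K * ∑ n ∈ Finset.range M, (t (n + 1) - t n) * ∑ l ∈ Finset.Ico 0 n,
          (t (l + 1) - t l) * (ρ (t (n + 1) - t l) / (t (n + 1) - t l) ^ (3 / 2 : ℝ)) *
            g (U l) := by
          rw [Finset.mul_sum]
          exact Finset.sum_congr rfl fun _ _ => by ring
      _ ≤ K * (J * (√(3 * T / (2 * α)) * D)) := by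
          have hK : 0 ≤ K := Real.sqrt_nonneg _
          gcongr
          exact h3.trans (by gcongr)
      _ = _ := by ring
  have h6 : (L + K * J * √(3 * T / (2 * α))) * D = L * ‖P 0‖ +
      L * ∑ l ∈ Finset.range M, ‖F l‖ + K * J * √(3 * T / (2 * α)) * D := by
    rw [add_mul, hD]; ring
  linarith

end Euler

/-- Solvability of `(z, φ) + k b(z, φ) = (h, φ)` by the Lax–Milgram theorem. -/
theorem exists_resolvent {V H : Type*} [NormedAddCommGroup V] [InnerProductSpace ℝ V]
    [CompleteSpace V] [NormedAddCommGroup H] [InnerProductSpace ℝ H] [CompleteSpace H]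
    (ι : V →L[ℝ] H) (b : LinearMap.BilinForm ℝ V) {C : ℝ} (hC : ∀ u v, |b u v| ≤ C * ‖u‖ * ‖v‖)
    {k c : ℝ} (hc : 0 < c) (hcoer : ∀ u, c * ‖u‖ ^ 2 ≤ ‖ι u‖ ^ 2 + k * b u u) (h : H) :
    ∃ z : V, ∀ φ, ⟪ι z, ι φ⟫ + k * b z φ = ⟪h, ι φ⟫ := by
  let B : V →L[ℝ] V →L[ℝ] ℝ :=
    ((innerₗ H).compl₁₂ (ι : V →ₗ[ℝ] H) (ι : V →ₗ[ℝ] H)).mkContinuous₂ (‖ι‖ * ‖ι‖) (fun u v =>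
      calc ‖⟪ι u, ι v⟫‖ ≤ ‖ι u‖ * ‖ι v‖ := norm_inner_le_norm _ _
        _ ≤ (‖ι‖ * ‖u‖) * (‖ι‖ * ‖v‖) := by gcongr <;> exact ι.le_opNorm _
        _ = _ := by ring) + k • b.mkContinuous₂ C hC
  have hB : ∀ u v, B u v = ⟪ι u, ι v⟫ + k * b u v := fun u v => by
    simp [B, LinearMap.mkContinuous₂_apply]
    rfl
  have hco : IsCoercive B := ⟨c, hc, fun u => by
    rw [hB, real_inner_self_eq_norm_sq, mul_assoc, ← sq]; exact hcoer u⟩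
  -- The adjoint of `ι` represents `φ ↦ ⟪h, ι φ⟫` by an element of `V`.
  refine ⟨hco.continuousLinearEquivOfBilin.symm (ContinuousLinearMap.adjoint ι h), fun φ => ?_⟩
  rw [← hB, ← hco.continuousLinearEquivOfBilin_apply, ContinuousLinearEquiv.apply_symm_apply,
    ContinuousLinearMap.adjoint_inner_left]

/-! ### Bounds and algebra of the time-dependent form on `H¹₀(Ω)`. -/

section Form

variable {d : ℕ} {Ω : Set (EuclideanSpace ℝ (Fin d))}

instance : CompleteSpace (H10 Ω) := by
  unfold H10; infer_instance

/-- The embedding `H¹₀(Ω) → L²(Ω)` as a continuous linear map. -/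
noncomputable def toL2L (Ω : Set (EuclideanSpace ℝ (Fin d))) : H10 Ω →L[ℝ] L2 Ω :=
  (WithLp.fstL 2 ℝ (L2 Ω) (L2Vec Ω)).comp (H10 Ω).subtypeL

theorem toL2L_apply (u : H10 Ω) : toL2L Ω u = toL2 u := rfl

theorem weakGrad_add (u v : H10 Ω) : weakGrad (u + v) = weakGrad u + weakGrad v := rfl

theorem weakGrad_smul (r : ℝ) (u : H10 Ω) : weakGrad (r • u) = r • weakGrad u := rfl

theorem norm_sq_H10 (u : H10 Ω) : ‖u‖ ^ 2 = ‖toL2 u‖ ^ 2 + ‖weakGrad u‖ ^ 2 :=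
  WithLp.prod_norm_sq_eq_of_L2 _

theorem norm_weakGrad_le (u : H10 Ω) : ‖weakGrad u‖ ≤ ‖u‖ := by
  refine le_of_sq_le_sq ?_ (norm_nonneg _)
  rw [norm_sq_H10]
  nlinarith [sq_nonneg ‖toL2 u‖]

theorem memLp_apply (f : L2Vec Ω) (i : Fin d) :
    MemLp (fun x => f x i) 2 (volume.restrict Ω) := by
  refine (Lp.memLp f).of_le ?_ (Filter.Eventually.of_forall fun x => ?_)
  · exact (EuclideanSpace.proj (𝕜 := ℝ) i).continuous.comp_aestronglyMeasurable
      (Lp.aestronglyMeasurable f)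
  · exact PiLp.norm_apply_le (f x) i

theorem integrable_apply_mul_apply (f g : L2Vec Ω) (i j : Fin d) :
    Integrable (fun x => f x i * g x j) (volume.restrict Ω) :=
  (memLp_apply f i).integrable_mul (memLp_apply g j)

theorem integrable_norm_mul_norm (f g : L2Vec Ω) :
    Integrable (fun x => ‖f x‖ * ‖g x‖) (volume.restrict Ω) :=
  (Lp.memLp f).norm.integrable_mul (Lp.memLp g).norm

theorem integral_norm_mul_norm_le (f g : L2Vec Ω) :
    ∫ x in Ω, ‖f x‖ * ‖g x‖ ≤ ‖f‖ * ‖g‖ := by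
  have hn : ∀ f : L2Vec Ω, ‖(Lp.memLp f).norm.toLp‖ = ‖f‖ := fun f => by
    rw [Lp.norm_toLp, eLpNorm_norm, Lp.norm_def]
  have h := real_inner_le_norm ((Lp.memLp f).norm.toLp) ((Lp.memLp g).norm.toLp)
  rw [hn, hn, L2.inner_def] at h
  refine (le_of_eq (integral_congr_ae ?_)).trans h
  filter_upwards [(Lp.memLp f).norm.coeFn_toLp, (Lp.memLp g).norm.coeFn_toLp] with x h1 h2
  rw [h1, h2]
  simp [mul_comm]

theorem integral_norm_sq (f : L2Vec Ω) : ∫ x in Ω, ‖f x‖ ^ 2 = ‖f‖ ^ 2 := by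
  rw [← real_inner_self_eq_norm_sq, L2.inner_def]
  simp

theorem abs_integral_coeff_le {c : Fin d → Fin d → EuclideanSpace ℝ (Fin d) → ℝ} {K : ℝ}
    (hK : 0 ≤ K) (hc : ∀ i j, ∀ᵐ x ∂(volume.restrict Ω), |c i j x| ≤ K) (f g : L2Vec Ω) :
    |∫ x in Ω, ∑ i, ∑ j, c i j x * f x i * g x j| ≤ (d : ℝ) ^ 2 * K * ‖f‖ * ‖g‖ := by
  have h1 : ∀ᵐ x ∂(volume.restrict Ω), ‖∑ i, ∑ j, c i j x * f x i * g x j‖ ≤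
      (d : ℝ) ^ 2 * K * (‖f x‖ * ‖g x‖) := by
    filter_upwards [ae_all_iff.mpr fun i => ae_all_iff.mpr fun j => hc i j] with x hx
    calc ‖∑ i, ∑ j, c i j x * f x i * g x j‖
        ≤ ∑ _i : Fin d, ∑ _j : Fin d, K * (‖f x‖ * ‖g x‖) := by
          refine (norm_sum_le _ _).trans (Finset.sum_le_sum fun i _ => ?_)
          refine (norm_sum_le _ _).trans (Finset.sum_le_sum fun j _ => ?_)
          rw [norm_mul, norm_mul, mul_assoc]
          gcongr
          · exact hx i j
          · exact PiLp.norm_apply_le (f x) i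
          · exact PiLp.norm_apply_le (g x) j
      _ = _ := by simp; ring
  refine (norm_integral_le_of_norm_le ((integrable_norm_mul_norm f g).const_mul _) h1).trans ?_
  rw [integral_const_mul, mul_assoc _ ‖f‖]
  exact mul_le_mul_of_nonneg_left (integral_norm_mul_norm_le f g) (by positivity)

theorem form_zero_right (a : Fin d → Fin d → ℝ → EuclideanSpace ℝ (Fin d) → ℝ) (t : ℝ)
    (u : H10 Ω) : form a t u 0 = 0 := by
  have h : (weakGrad (0 : H10 Ω) : EuclideanSpace ℝ (Fin d) → EuclideanSpace ℝ (Fin d))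
      =ᵐ[volume.restrict Ω] 0 := Lp.coeFn_zero _ _ _
  refine integral_eq_zero_of_ae ?_
  filter_upwards [h] with x hx
  simp [hx]

theorem form_smul_left (a : Fin d → Fin d → ℝ → EuclideanSpace ℝ (Fin d) → ℝ) (t r : ℝ)
    (u v : H10 Ω) : form a t (r • u) v = r * form a t u v := by
  rw [form, form, ← integral_const_mul]
  refine integral_congr_ae ?_
  filter_upwards [Lp.coeFn_smul r (weakGrad u)] with x hx
  rw [weakGrad_smul, hx]
  simp only [Pi.smul_apply, PiLp.smul_apply, smul_eq_mul, Finset.mul_sum]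
  exact Finset.sum_congr rfl fun i _ => Finset.sum_congr rfl fun j _ => by ring

variable {T α : ℝ} {ω : ℝ → ℝ} {a : Fin d → Fin d → ℝ → EuclideanSpace ℝ (Fin d) → ℝ}

theorem restrict_Ioo_eq_Ioc (T : ℝ) :
    (volume.restrict (Ioo 0 T) : Measure ℝ) = volume.restrict (Ioc 0 T) :=
  Measure.restrict_congr_set Ioo_ae_eq_Ioc

namespace IsAdmissibleCoeff

theorem integrable_prod (ha : IsAdmissibleCoeff Ω T α ω a) (u v : H10 Ω) :
    Integrable (fun p : ℝ × EuclideanSpace ℝ (Fin d) =>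
      ∑ i, ∑ j, a i j p.1 p.2 * weakGrad u p.2 i * weakGrad v p.2 j)
      ((volume.restrict (Ioc 0 T)).prod (volume.restrict Ω)) := by
  refine integrable_finsetSum _ fun i _ => integrable_finsetSum _ fun j _ => ?_
  have h1 := (integrable_apply_mul_apply (weakGrad u) (weakGrad v) i j).comp_snd
    (volume.restrict (Ioc 0 T))
  have h2 := ha.memLp i j
  rw [restrict_Ioo_eq_Ioc] at h2
  exact (h1.mul_of_top_right h2).congr (Filter.Eventually.of_forall fun p => (mul_assoc _ _ _).symm)

theorem integrableOn_form (ha : IsAdmissibleCoeff Ω T α ω a) (u v : H10 Ω) :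
    IntegrableOn (fun t => form a t u v) (Ioc 0 T) :=
  (ha.integrable_prod u v).integral_prod_left

/-- Coefficients are controlled jointly in `(t, x)`, so Fubini gives integrability in space only for
almost every `t`. Additivity of the form is therefore also an almost-everywhere statement. -/
theorem ae_integrable (ha : IsAdmissibleCoeff Ω T α ω a) (u v : H10 Ω) :
    ∀ᵐ t ∂(volume.restrict (Ioc 0 T)), Integrable (fun x =>
      ∑ i, ∑ j, a i j t x * weakGrad u x i * weakGrad v x j) (volume.restrict Ω) :=
  (ha.integrable_prod u v).prod_right_ae

theorem ae_form_symm (ha : IsAdmissibleCoeff Ω T α ω a) (u v : H10 Ω) :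
    ∀ᵐ t ∂(volume.restrict (Ioc 0 T)), form a t u v = form a t v u := by
  have h : ∀ᵐ p ∂((volume.restrict (Ioc 0 T)).prod (volume.restrict Ω)),
      ∀ i j, a i j p.1 p.2 = a j i p.1 p.2 := by
    rw [← restrict_Ioo_eq_Ioc]
    exact ae_all_iff.mpr fun i => ae_all_iff.mpr fun j => ha.symm i j
  filter_upwards [Measure.ae_ae_of_ae_prod h] with t ht
  refine integral_congr_ae ?_
  filter_upwards [ht] with x hx
  rw [Finset.sum_comm]
  exact Finset.sum_congr rfl fun i _ => Finset.sum_congr rfl fun j _ => by rw [hx j i]; ring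

theorem ae_form_add_left (ha : IsAdmissibleCoeff Ω T α ω a) (u u' v : H10 Ω) :
    ∀ᵐ t ∂(volume.restrict (Ioc 0 T)), form a t (u + u') v = form a t u v + form a t u' v := by
  filter_upwards [ha.ae_integrable u v, ha.ae_integrable u' v] with t h1 h2
  rw [form, form, form, ← integral_add h1 h2]
  refine integral_congr_ae ?_
  filter_upwards [Lp.coeFn_add (weakGrad u) (weakGrad u')] with x hx
  rw [weakGrad_add, hx]
  simp only [Pi.add_apply, PiLp.add_apply, ← Finset.sum_add_distrib]
  exact Finset.sum_congr rfl fun i _ => Finset.sum_congr rfl fun j _ => by ring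

theorem ae_le_form_self (ha : IsAdmissibleCoeff Ω T α ω a) (u : H10 Ω) :
    ∀ᵐ t ∂(volume.restrict (Ioc 0 T)), α * ‖weakGrad u‖ ^ 2 ≤ form a t u u := by
  have h := ha.elliptic
  rw [restrict_Ioo_eq_Ioc] at h
  filter_upwards [Measure.ae_ae_of_ae_prod h, ha.ae_integrable u u] with t ht hi
  rw [← integral_norm_sq, ← integral_const_mul]
  refine integral_mono_ae ?_ hi ?_
  · simpa only [sq] using (integrable_norm_mul_norm (weakGrad u) (weakGrad u)).const_mul α
  · filter_upwards [ht] with x hx using hx _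

theorem exists_abs_form_le (ha : IsAdmissibleCoeff Ω T α ω a) :
    ∃ K, 0 ≤ K ∧ ∀ u v : H10 Ω, ∀ᵐ t ∂(volume.restrict (Ioc 0 T)),
      |form a t u v| ≤ K * ‖weakGrad u‖ * ‖weakGrad v‖ := by
  have h1 : ∀ i j, ∃ K : ℝ, 0 ≤ K ∧
      ∀ᵐ p ∂((volume.restrict (Ioc 0 T)).prod (volume.restrict Ω)), |a i j p.1 p.2| ≤ K := by
    intro i j
    have h := ha.memLp i j
    rw [restrict_Ioo_eq_Ioc] at h
    refine ⟨(eLpNormEssSup (fun p : ℝ × EuclideanSpace ℝ (Fin d) => a i j p.1 p.2)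
      ((volume.restrict (Ioc 0 T)).prod (volume.restrict Ω))).toReal, ENNReal.toReal_nonneg, ?_⟩
    filter_upwards [ae_le_eLpNormEssSup (f := fun p : ℝ × EuclideanSpace ℝ (Fin d) =>
      a i j p.1 p.2) (μ := (volume.restrict (Ioc 0 T)).prod (volume.restrict Ω))] with p hp
    have h2 := ENNReal.toReal_mono (by simpa using h.eLpNorm_lt_top.ne) hp
    simpa using h2
  choose K hK0 hK using h1
  have hle : ∀ i j, K i j ≤ ∑ i, ∑ j, K i j := fun i j =>
    (Finset.single_le_sum (f := fun j => K i j) (fun j _ => hK0 i j) (Finset.mem_univ j)).trans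
      (Finset.single_le_sum (f := fun i => ∑ j, K i j)
        (fun i _ => Finset.sum_nonneg fun j _ => hK0 i j) (Finset.mem_univ i))
  have hs : 0 ≤ ∑ i, ∑ j, K i j := Finset.sum_nonneg fun i _ => Finset.sum_nonneg fun j _ => hK0 i j
  refine ⟨(d : ℝ) ^ 2 * ∑ i, ∑ j, K i j, by positivity, fun u v => ?_⟩
  filter_upwards [ae_all_iff.mpr fun i => ae_all_iff.mpr fun j =>
    Measure.ae_ae_of_ae_prod (hK i j)] with t ht
  refine abs_integral_coeff_le hs (fun i j => ?_) _ _
  filter_upwards [ht i j] with x hx using hx.trans (hle i j)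

theorem ae_abs_form_sub_form_le (ha : IsAdmissibleCoeff Ω T α ω a) (hω : IsModulus T ω)
    (u v : H10 Ω) : ∀ᵐ t ∂(volume.restrict (Ioc 0 T)), ∀ᵐ s ∂(volume.restrict (Ioc 0 T)),
      |form a t u v - form a s u v| ≤
        (d : ℝ) ^ 2 * ω |t - s| * ‖weakGrad u‖ * ‖weakGrad v‖ := by
  filter_upwards [ha.ae_integrable u v, ae_restrict_mem measurableSet_Ioc] with t h1 ht
  filter_upwards [ha.ae_integrable u v, ae_restrict_mem measurableSet_Ioc] with s h2 hs
  rw [form, form, ← integral_sub h1 h2]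
  have h3 : |t - s| ∈ Icc 0 T :=
    ⟨abs_nonneg _, abs_le.mpr ⟨by linarith [ht.1, hs.2], by linarith [ht.2, hs.1]⟩⟩
  refine le_trans (le_of_eq ?_) (abs_integral_coeff_le (c := fun i j x => a i j t x - a i j s x)
    (hω.nonneg _ h3)
    (fun i j => ha.modulus i j t (Ioc_subset_Icc_self ht) s (Ioc_subset_Icc_self hs)) _ _)
  congr 2
  ext x
  simp only [← Finset.sum_sub_distrib]
  exact Finset.sum_congr rfl fun i _ => Finset.sum_congr rfl fun j _ => by ring

end IsAdmissibleCoeff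

end Form

/-! ### Comparing time averages. -/

section Average

theorem abs_average_sub_le {X : ℝ → ℝ} {p q c K : ℝ} (hpq : p < q)
    (hX : IntegrableOn X (Ioc p q)) (h : ∀ᵐ t ∂(volume.restrict (Ioc p q)), |X t - c| ≤ K) :
    |(q - p)⁻¹ * (∫ t in Ioc p q, X t) - c| ≤ K := by
  have hk : 0 < q - p := sub_pos.mpr hpq
  have h1 : ∫ t in Ioc p q, (X t - c) = (∫ t in Ioc p q, X t) - (q - p) * c := by
    rw [integral_sub hX (integrableOn_const (by simp)), setIntegral_const, smul_eq_mul,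
      Real.volume_real_Ioc_of_le hpq.le]
  have h2 : ‖∫ t in Ioc p q, (X t - c)‖ ≤ K * (volume : Measure ℝ).real (Ioc p q) := by
    have := norm_integral_le_of_norm_le_const (μ := volume.restrict (Ioc p q))
      (f := fun t => X t - c) h
    simpa using this
  rw [h1, Real.volume_real_Ioc_of_le hpq.le, Real.norm_eq_abs] at h2
  have h3 : (q - p)⁻¹ * (∫ t in Ioc p q, X t) - c =
      (q - p)⁻¹ * ((∫ t in Ioc p q, X t) - (q - p) * c) := by
    field_simp
  rw [h3, abs_mul, abs_of_pos (inv_pos.mpr hk), inv_mul_le_iff₀ hk, mul_comm _ K]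
  exact h2

theorem abs_average_sub_average_le {X : ℝ → ℝ} {p q p' q' K : ℝ} (hpq : p < q) (hpq' : p' < q')
    (hX : IntegrableOn X (Ioc p q)) (hX' : IntegrableOn X (Ioc p' q'))
    (h : ∀ᵐ t ∂(volume.restrict (Ioc p q)), ∀ᵐ s ∂(volume.restrict (Ioc p' q')),
      |X t - X s| ≤ K) :
    |(q - p)⁻¹ * (∫ t in Ioc p q, X t) - (q' - p')⁻¹ * ∫ t in Ioc p' q', X t| ≤ K := by
  refine abs_average_sub_le hpq hX ?_
  filter_upwards [h] with t ht
  rw [abs_sub_comm]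
  refine abs_average_sub_le hpq' hX' ?_
  filter_upwards [ht] with s hs
  rwa [abs_sub_comm]

end Average

/-! ### From dG(0) to implicit Euler, and the averaged forms. -/

namespace TimeMesh

variable {T : ℝ} (τ : TimeMesh T)

theorem node_mono {l n : ℕ} (h : l ≤ n) (hn : n ≤ τ.M) : τ.node l ≤ τ.node n := by
  induction n, h using Nat.le_induction with
  | base => rfl
  | succ m _ ih => exact (ih (by omega)).trans (τ.node_lt m (by omega)).le

theorem node_nonneg {m : ℕ} (hm : m ≤ τ.M) : 0 ≤ τ.node m :=
  τ.node_zero.ge.trans (τ.node_mono (Nat.zero_le m) hm)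

theorem node_le {m : ℕ} (hm : m ≤ τ.M) : τ.node m ≤ T :=
  (τ.node_mono hm le_rfl).trans τ.node_last.le

theorem step_pos {m : ℕ} (hm : m < τ.M) : 0 < τ.step m := sub_pos.mpr (τ.node_lt m hm)

theorem Ioc_node_subset {m : ℕ} (hm : m < τ.M) :
    Ioc (τ.node m) (τ.node (m + 1)) ⊆ Ioc 0 T :=
  Ioc_subset_Ioc (τ.node_nonneg hm.le) (τ.node_le hm)

theorem node_mem_Ioc_iff {m j : ℕ} (hm : m < τ.M) (hj : j < τ.M) :
    τ.node (j + 1) ∈ Ioc (τ.node m) (τ.node (m + 1)) ↔ j = m := by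
  refine ⟨fun h => ?_, fun h => h ▸ ⟨τ.node_lt j hj, le_rfl⟩⟩
  by_contra hne
  rcases Nat.lt_or_gt_of_ne hne with h1 | h1
  · exact absurd h.1 (not_lt.mpr (τ.node_mono h1 hm.le))
  · exact absurd (h.2.trans (τ.node_mono h1 hj.le)) (not_le.mpr (τ.node_lt j hj))

theorem sum_integral_Ioc_node {E : Type*} [NormedAddCommGroup E] [NormedSpace ℝ E] {f : ℝ → E}
    (hf : IntegrableOn f (Ioc 0 T)) :
    ∑ m ∈ Finset.range τ.M, ∫ t in Ioc (τ.node m) (τ.node (m + 1)), f t =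
      ∫ t in Ioc 0 T, f t := by
  have h : ∀ n ≤ τ.M, ∑ m ∈ Finset.range n, ∫ t in Ioc (τ.node m) (τ.node (m + 1)), f t =
      ∫ t in Ioc 0 (τ.node n), f t := by
    intro n
    induction n with
    | zero => simp [τ.node_zero]
    | succ n ih =>
      intro hn
      have h0 : 0 ≤ τ.node n := τ.node_nonneg (by omega)
      have hsub := τ.Ioc_node_subset hn
      rw [Finset.sum_range_succ, ih (by omega), ← Ioc_union_Ioc_eq_Ioc h0 (τ.node_lt n hn).le,
        setIntegral_union (Ioc_disjoint_Ioc_of_le le_rfl) measurableSet_Ioc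
          (hf.mono_set (Ioc_subset_Ioc_right (τ.node_le (by omega)))) (hf.mono_set hsub)]
  rw [h τ.M le_rfl, τ.node_last]

variable {d : ℕ} {Ω : Set (EuclideanSpace ℝ (Fin d))} {α : ℝ} {ω : ℝ → ℝ}
  {a : Fin d → Fin d → ℝ → EuclideanSpace ℝ (Fin d) → ℝ}

theorem indicator_mem_dG0Space {m : ℕ} (hm : m < τ.M) (v : H10 Ω) :
    (Ioc (τ.node m) (τ.node (m + 1))).indicator (fun _ => v) ∈ τ.dG0Space Ω := by
  intro j hj t ht
  rcases eq_or_ne j m with rfl | hne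
  · rw [indicator_of_mem ht, indicator_of_mem ((τ.node_mem_Ioc_iff hm hj).mpr rfl)]
  · rw [indicator_of_notMem (fun h => hne ((τ.node_mem_Ioc_iff hm hj).mp h)),
      indicator_of_notMem]
    rintro ⟨h1, h2⟩
    rcases Nat.lt_or_gt_of_ne hne with h | h
    · exact absurd (ht.2.trans (τ.node_mono h hm.le)) (not_le.mpr h1)
    · exact absurd (h2.trans (τ.node_mono h hj.le)) (not_le.mpr ht.1)

theorem indicator_node {m j : ℕ} (hm : m < τ.M) (hj : j < τ.M) (v : H10 Ω) :
    (Ioc (τ.node m) (τ.node (m + 1))).indicator (fun _ => v) (τ.node (j + 1)) =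
      if j = m then v else 0 := by
  simp only [indicator_apply, τ.node_mem_Ioc_iff hm hj]

/-- The value of the dG(0) solution before the step from `t_m` to `t_{m+1}`. -/
noncomputable def previous (u₀ : L2 Ω) (u : ℝ → H10 Ω) (m : ℕ) : L2 Ω :=
  if m = 0 then u₀ else toL2 (u (τ.node m))

theorem toL2_ite (p : Prop) [Decidable p] (v : H10 Ω) :
    toL2 (if p then v else 0) = if p then toL2 v else 0 := by
  split_ifs
  · rfl
  · rfl

/-- The dG(0) method is an implicit Euler method. -/
theorem IsDG0Solution.euler {f : ℝ → L2 Ω} (hf : IntegrableOn f (Ioc 0 T)) {u₀ : L2 Ω}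
    {u : ℝ → H10 Ω} (hu : τ.IsDG0Solution a f u₀ u) {m : ℕ} (hm : m < τ.M) (v : H10 Ω) :
    ⟪toL2 (u (τ.node (m + 1))) - τ.previous u₀ u m, toL2 v⟫ +
      τ.step m * τ.avgOp a m (u (τ.node (m + 1))) v =
      ⟪∫ t in Ioc (τ.node m) (τ.node (m + 1)), f t, toL2 v⟫ := by
  have h := hu.2 _ (τ.indicator_mem_dG0Space hm v)
  have hsub := τ.Ioc_node_subset hm
  have h1 : ∫ t in Ioc 0 T, form a t (u t)
      ((Ioc (τ.node m) (τ.node (m + 1))).indicator (fun _ => v) t) =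
      τ.step m * τ.avgOp a m (u (τ.node (m + 1))) v := by
    rw [avgOp, mul_inv_cancel_left₀ (τ.step_pos hm).ne', ← inter_eq_self_of_subset_right hsub,
      ← setIntegral_indicator measurableSet_Ioc, inter_eq_self_of_subset_right hsub]
    congr 1
    ext t
    by_cases ht : t ∈ Ioc (τ.node m) (τ.node (m + 1))
    · rw [indicator_of_mem ht, indicator_of_mem ht, hu.1 m hm t ht]
    · rw [indicator_of_notMem ht, indicator_of_notMem ht, form_zero_right]
  have h2 : ∫ t in Ioc 0 T, ⟪f t, toL2
      ((Ioc (τ.node m) (τ.node (m + 1))).indicator (fun _ => v) t)⟫ =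
      ⟪∫ t in Ioc (τ.node m) (τ.node (m + 1)), f t, toL2 v⟫ := by
    rw [real_inner_comm, ← integral_inner (hf.mono_set hsub)]
    conv_rhs => rw [← inter_eq_self_of_subset_right hsub]
    rw [← setIntegral_indicator measurableSet_Ioc]
    congr 1
    ext t
    by_cases ht : t ∈ Ioc (τ.node m) (τ.node (m + 1))
    · rw [indicator_of_mem ht, indicator_of_mem ht, real_inner_comm]
    · rw [indicator_of_notMem ht, indicator_of_notMem ht]
      exact inner_zero_right _
  have h3 := τ.indicator_node hm τ.M_pos v
  rw [zero_add] at h3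
  -- The jump sum omits the first subinterval; for `m = 0` the contribution comes from the separate
  -- initial term instead.
  have h4 : ∑ j ∈ Finset.Ico 1 τ.M,
      ⟪toL2 (u (τ.node (j + 1))) - toL2 (u (τ.node j)), toL2
        ((Ioc (τ.node m) (τ.node (m + 1))).indicator (fun _ => v) (τ.node (j + 1)))⟫ =
      if m = 0 then 0 else ⟪toL2 (u (τ.node (m + 1))) - toL2 (u (τ.node m)), toL2 v⟫ := by
    calc _ = ∑ j ∈ Finset.Ico 1 τ.M, if j = m then
          ⟪toL2 (u (τ.node (m + 1))) - toL2 (u (τ.node m)), toL2 v⟫ else 0 := by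
          refine Finset.sum_congr rfl fun j hj => ?_
          rw [τ.indicator_node hm (Finset.mem_Ico.mp hj).2, toL2_ite]
          split_ifs with hjm
          · rw [hjm]
          · exact inner_zero_right _
      _ = _ := by
          rw [Finset.sum_ite_eq']
          by_cases h0 : m = 0
          · simp [h0]
          · rw [if_pos (Finset.mem_Ico.mpr ⟨by omega, hm⟩), if_neg h0]
  rw [dGForm, h1, h2, h3, h4, toL2_ite] at h
  rw [previous]
  rcases eq_or_ne m 0 with rfl | h0
  · simp only [if_true, zero_add] at h ⊢
    rw [inner_sub_left]
    linarith
  · simp only [if_neg h0, if_neg h0.symm, inner_zero_right] at h ⊢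
    linarith

theorem integrableOn_form_node (ha : IsAdmissibleCoeff Ω T α ω a) {m : ℕ} (hm : m < τ.M)
    (u v : H10 Ω) :
    IntegrableOn (fun t => form a t u v) (Ioc (τ.node m) (τ.node (m + 1))) :=
  (ha.integrableOn_form u v).mono_set (τ.Ioc_node_subset hm)

/-- Averaging removes the exceptional null set of times, so the identity becomes exact; the same
holds for additivity. -/
theorem avgOp_symm (ha : IsAdmissibleCoeff Ω T α ω a) {m : ℕ} (hm : m < τ.M) (u v : H10 Ω) :
    τ.avgOp a m u v = τ.avgOp a m v u := by
  rw [avgOp, avgOp]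
  congr 1
  exact integral_congr_ae
    (ae_mono (Measure.restrict_mono (τ.Ioc_node_subset hm) le_rfl) (ha.ae_form_symm u v))

theorem avgOp_add_left (ha : IsAdmissibleCoeff Ω T α ω a) {m : ℕ} (hm : m < τ.M)
    (u u' v : H10 Ω) : τ.avgOp a m (u + u') v = τ.avgOp a m u v + τ.avgOp a m u' v := by
  rw [avgOp, avgOp, avgOp, ← mul_add, ← integral_add (τ.integrableOn_form_node ha hm u v)
    (τ.integrableOn_form_node ha hm u' v)]
  congr 1
  exact integral_congr_ae (ae_mono (Measure.restrict_mono (τ.Ioc_node_subset hm) le_rfl)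
    (ha.ae_form_add_left u u' v))

theorem avgOp_smul_left (m : ℕ) (r : ℝ) (u v : H10 Ω) :
    τ.avgOp a m (r • u) v = r * τ.avgOp a m u v := by
  simp only [avgOp, form_smul_left, integral_const_mul]
  ring

/-- The averaged form `⟨A_k u, v⟩` as a bilinear form. -/
noncomputable def avgForm (ha : IsAdmissibleCoeff Ω T α ω a) (m : ℕ) : LinearMap.BilinForm ℝ (H10 Ω) :=
  if hm : m < τ.M then
    LinearMap.mk₂ ℝ (τ.avgOp a m) (τ.avgOp_add_left ha hm) (τ.avgOp_smul_left m)
      (fun u v v' => by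
        rw [τ.avgOp_symm ha hm, τ.avgOp_add_left ha hm, τ.avgOp_symm ha hm v,
          τ.avgOp_symm ha hm v'])
      (fun r u v => by
        rw [τ.avgOp_symm ha hm, τ.avgOp_smul_left, τ.avgOp_symm ha hm v, smul_eq_mul])
  else 0

theorem avgForm_apply (ha : IsAdmissibleCoeff Ω T α ω a) {m : ℕ} (hm : m < τ.M) (u v : H10 Ω) :
    τ.avgForm ha m u v = τ.avgOp a m u v := by
  rw [avgForm, dif_pos hm, LinearMap.mk₂_apply]

theorem le_avgForm_self (ha : IsAdmissibleCoeff Ω T α ω a) {m : ℕ} (hm : m < τ.M) (u : H10 Ω) :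
    α * ‖weakGrad u‖ ^ 2 ≤ τ.avgForm ha m u u := by
  have h := setIntegral_mono_ae_restrict (μ := volume) (s := Ioc (τ.node m) (τ.node (m + 1)))
    (integrableOn_const (by simp)) (τ.integrableOn_form_node ha hm u u)
    (ae_mono (Measure.restrict_mono (τ.Ioc_node_subset hm) le_rfl) (ha.ae_le_form_self u))
  rw [setIntegral_const, smul_eq_mul, Real.volume_real_Ioc_of_le (τ.node_lt m hm).le] at h
  rw [τ.avgForm_apply ha hm, avgOp, le_inv_mul_iff₀ (τ.step_pos hm)]
  exact h

/-- Times in the two subintervals differ by at most `node (n+1) - node l`, and `ω` is monotone. This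
is the same distance that appears in the smoothing weights. -/
theorem abs_avgForm_sub_le (ha : IsAdmissibleCoeff Ω T α ω a) (hω : IsModulus T ω) {n l : ℕ}
    (hn : n < τ.M) (hl : l < n) (u v : H10 Ω) :
    |τ.avgForm ha n u v - τ.avgForm ha l u v| ≤
      (d : ℝ) ^ 2 * ω (τ.node (n + 1) - τ.node l) * ‖weakGrad u‖ * ‖weakGrad v‖ := by
  have hl' : l < τ.M := hl.trans hn
  rw [τ.avgForm_apply ha hn, τ.avgForm_apply ha hl']
  refine abs_average_sub_average_le (τ.node_lt n hn) (τ.node_lt l hl')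
    (τ.integrableOn_form_node ha hn u v) (τ.integrableOn_form_node ha hl' u v) ?_
  filter_upwards [ae_mono (Measure.restrict_mono (τ.Ioc_node_subset hn) le_rfl)
    (ha.ae_abs_form_sub_form_le hω u v), ae_restrict_mem measurableSet_Ioc] with t h1 ht
  filter_upwards [ae_mono (Measure.restrict_mono (τ.Ioc_node_subset hl') le_rfl) h1,
    ae_restrict_mem measurableSet_Ioc] with s h2 hs
  refine h2.trans ?_
  have h3 := τ.node_mono (show l + 1 ≤ n by omega) hn.le
  have h4 : |t - s| ≤ τ.node (n + 1) - τ.node l := by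
    rw [abs_le]; constructor <;> linarith [ht.1, ht.2, hs.1, hs.2]
  have h5 : τ.node (n + 1) - τ.node l ≤ T := by linarith [τ.node_le hn, τ.node_nonneg hl'.le]
  have := hω.monotoneOn ⟨abs_nonneg (t - s), h4.trans h5⟩ ⟨(abs_nonneg _).trans h4, h5⟩ h4
  gcongr

theorem exists_abs_avgForm_le (ha : IsAdmissibleCoeff Ω T α ω a) {m : ℕ} (hm : m < τ.M) :
    ∃ K, ∀ u v, |τ.avgForm ha m u v| ≤ K * ‖u‖ * ‖v‖ := by
  obtain ⟨K, hK0, hK⟩ := ha.exists_abs_form_le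
  refine ⟨K, fun u v => ?_⟩
  rw [τ.avgForm_apply ha hm]
  have h := abs_average_sub_le (c := 0) (K := K * ‖weakGrad u‖ * ‖weakGrad v‖)
    (τ.node_lt m hm) (τ.integrableOn_form_node ha hm u v) (by
      filter_upwards [ae_mono (Measure.restrict_mono (τ.Ioc_node_subset hm) le_rfl) (hK u v)]
        with t ht
      simpa using ht)
  rw [sub_zero] at h
  refine h.trans ?_
  have := norm_weakGrad_le u
  have := norm_weakGrad_le v
  gcongr

/-- The `L²` part of the `H¹` norm is supplied by the mass term, so coercivity with constant `min 1
(k * α)` needs no Poincaré inequality. -/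
theorem exists_resolvent_avgForm (ha : IsAdmissibleCoeff Ω T α ω a) (hα : 0 < α) {m : ℕ}
    (hm : m < τ.M) {k : ℝ} (hk : 0 < k) (h : L2 Ω) :
    ∃ z : H10 Ω, ∀ φ, ⟪toL2L Ω z, toL2L Ω φ⟫ + k * τ.avgForm ha m z φ = ⟪h, toL2L Ω φ⟫ := by
  obtain ⟨K, hK⟩ := τ.exists_abs_avgForm_le ha hm
  refine exists_resolvent (toL2L Ω) (τ.avgForm ha m) hK (c := min 1 (k * α))
    (lt_min one_pos (mul_pos hk hα)) (fun u => ?_) h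
  rw [norm_sq_H10, toL2L_apply]
  have h1 := mul_le_mul_of_nonneg_left (τ.le_avgForm_self ha hm u) hk.le
  have h2 := mul_le_mul_of_nonneg_right (min_le_left 1 (k * α)) (sq_nonneg ‖toL2 u‖)
  have h3 := mul_le_mul_of_nonneg_right (min_le_right 1 (k * α)) (sq_nonneg ‖weakGrad u‖)
  linarith

end TimeMesh

/-! ### Logarithms of admissible meshes. -/

namespace TimeMesh

variable {T : ℝ} (τ : TimeMesh T)

theorem step_le_kmax {m : ℕ} (hm : m < τ.M) : τ.step m ≤ τ.kmax :=
  Finset.le_sup' τ.step (Finset.mem_range.mpr hm)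

theorem kmin_le_step {m : ℕ} (hm : m < τ.M) : τ.kmin ≤ τ.step m :=
  Finset.inf'_le τ.step (Finset.mem_range.mpr hm)

theorem kmax_pos : 0 < τ.kmax := (τ.step_pos τ.M_pos).trans_le (τ.step_le_kmax τ.M_pos)

/-- The bound `k ≤ T/4` works because `4 > e`; it lets additive constants be absorbed into the
logarithm. -/
theorem IsAdmissible.one_le_log {c β κ : ℝ} (h : τ.IsAdmissible c β κ) :
    1 ≤ Real.log (T / τ.kmax) := by
  have h1 : 4 ≤ T / τ.kmax := by
    rw [le_div_iff₀ τ.kmax_pos]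
    linarith [h.kmax_le]
  rw [Real.le_log_iff_exp_le (by linarith)]
  linarith [Real.exp_one_lt_d9]

/-- The lower bound `c k^β` on every step turns a logarithm in the local step into `β log (T/k)`
plus a constant. -/
theorem IsAdmissible.log_le {c β κ : ℝ} (hc : 0 < c) (h : τ.IsAdmissible c β κ) {s m : ℕ}
    (hm : m < τ.M) (hs : s < τ.M) :
    1 + Real.log ((τ.node τ.M - τ.node s) / τ.step m) ≤
      (1 + |Real.log T - Real.log c - β * Real.log T| + β) * Real.log (T / τ.kmax) := by
  have hk := τ.kmax_pos
  have hL := h.one_le_log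
  have hT : 0 < T := by linarith [h.kmax_le]
  have hlow : 0 < c * τ.kmax ^ β := by positivity
  have h1 : c * τ.kmax ^ β ≤ τ.step m := h.le_kmin.trans (τ.kmin_le_step hm)
  have h2 : 0 < τ.node τ.M - τ.node s := by
    linarith [τ.node_lt s hs, τ.node_mono hs le_rfl]
  have h3 : τ.node τ.M - τ.node s ≤ T := by linarith [τ.node_le le_rfl, τ.node_nonneg hs.le]
  have h4 : Real.log ((τ.node τ.M - τ.node s) / τ.step m) ≤ Real.log (T / (c * τ.kmax ^ β)) := by
    refine Real.log_le_log (div_pos h2 (τ.step_pos hm)) ?_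
    gcongr
  rw [Real.log_div hT.ne' hlow.ne', Real.log_mul hc.ne' (by positivity),
    Real.log_rpow hk] at h4
  have h5 := Real.log_div hT.ne' hk.ne'
  have h6 := le_abs_self (Real.log T - Real.log c - β * Real.log T)
  have h7 := mul_le_mul_of_nonneg_left hL (abs_nonneg (Real.log T - Real.log c - β * Real.log T))
  rw [mul_one] at h7
  have h8 : β * Real.log (T / τ.kmax) = β * Real.log T - β * Real.log τ.kmax := by rw [h5]; ring
  linarith

end TimeMesh

end DGParabolic

open DGParabolic in
/-- Discrete maximal parabolic regularity of the dG(0) method for `p = 1`. Here `w m` is the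
`L²(Ω)` function that represents `A_{k,m+1} u_{k,m+1} ∈ H⁻¹(Ω)`. -/
theorem theorem3p2 {d : ℕ} (hd : 1 ≤ d)
    (Ω : Set (EuclideanSpace ℝ (Fin d))) (hΩ : IsLipschitzDomain Ω)
    (T : ℝ) (hT : 0 < T) (α : ℝ) (hα : 0 < α)
    (ω : ℝ → ℝ) (hω : IsModulus T ω)
    (a : Fin d → Fin d → ℝ → EuclideanSpace ℝ (Fin d) → ℝ)
    (ha : IsAdmissibleCoeff Ω T α ω a)
    (c β κ : ℝ) (hc : 0 < c) (hβ : 0 < β) (hκ : 0 < κ) :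
    ∃ C : ℝ, 0 < C ∧ ∃ μ₀ : ℝ, 0 < μ₀ ∧ ∀ μ : ℝ, μ₀ ≤ μ → ∃ δ₀ : ℝ, 0 < δ₀ ∧
      ∀ τ : TimeMesh T, τ.IsAdmissible c β κ → τ.kmax - τ.kmin ≤ δ₀ →
      ∀ f : ℝ → L2 Ω, IntegrableOn f (Ioc 0 T) → ∀ u₀ : L2 Ω,
      ∀ u : ℝ → H10 Ω, τ.IsDG0Solution a f u₀ u →
      ∃ w : ℕ → L2 Ω,
        (∀ m < τ.M, ∀ v : H10 Ω, τ.avgOp a m (u (τ.node (m + 1))) v = ⟪w m, toL2 v⟫) ∧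
        ∑ m ∈ Finset.range τ.M, (τ.step m * ‖w m‖ + ‖τ.jump u₀ u m‖) ≤
          C * Real.exp (μ * T) * Real.log (T / τ.kmax) *
            ((∫ t in Ioc 0 T, ‖f t‖) + ‖u₀‖) := by
  -- The dual chain continues with equal steps beyond the mesh, which requires a ratio bound of at
  -- least 1.
  set κ' := max 1 κ with hκ'
  set ρ : ℝ → ℝ := fun s => (d : ℝ) ^ 2 * ω s with hρ
  have hρe : (fun s => ρ s / s ^ (3 / 2 : ℝ)) = fun s => (d : ℝ) ^ 2 * (ω s / s ^ (3 / 2 : ℝ)) := by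
    ext s; simp only [hρ, mul_div_assoc]
  have hρ0 : ∀ s ∈ Ioc 0 T, 0 ≤ ρ s := fun s hs =>
    mul_nonneg (by positivity) (hω.nonneg s (Ioc_subset_Icc_self hs))
  have hρa : AntitoneOn (fun s => ρ s / s ^ (3 / 2 : ℝ)) (Ioc 0 T) := by
    rw [hρe]
    exact fun s hs t ht hst => mul_le_mul_of_nonneg_left (hω.antitoneOn hs ht hst) (by positivity)
  have hρi : IntegrableOn (fun s => ρ s / s ^ (3 / 2 : ℝ)) (Ioc 0 T) := by
    rw [hρe]
    exact hω.integrableOn.const_mul _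
  set E := √(3 * (1 + κ') ^ 2 / (2 * α)) * (∫ s in Ioc 0 T, ρ s / s ^ (3 / 2 : ℝ)) *
    √(3 * T / (2 * α)) with hE
  have hE0 : 0 ≤ E := by
    refine mul_nonneg (mul_nonneg (Real.sqrt_nonneg _) ?_) (Real.sqrt_nonneg _)
    exact setIntegral_nonneg measurableSet_Ioc fun s hs =>
      div_nonneg (hρ0 s hs) (Real.rpow_nonneg hs.1.le _)
  set L₀ := 1 + |Real.log T - Real.log c - β * Real.log T| + β
  have hL₀ : 0 < L₀ := by positivity
  -- The 2 counts `w` once directly and once through the jump `F m - step m • w m`; the 1 is for the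
  -- sum of `‖F m‖`. The estimate holds already without the exponential, so `μ₀ = δ₀ = 1` is an
  -- arbitrary choice.
  refine ⟨2 * (L₀ + E) + 1, by positivity, 1, one_pos, fun μ hμ => ⟨1, one_pos, ?_⟩⟩
  intro τ hτ _ f hf u₀ u hu
  set F : ℕ → L2 Ω := fun m => ∫ t in Ioc (τ.node m) (τ.node (m + 1)), f t
  set w : ℕ → L2 Ω := fun m =>
    (τ.step m)⁻¹ • (F m - (toL2 (u (τ.node (m + 1))) - τ.previous u₀ u m)) with hwdef
  have hw' : ∀ m < τ.M, τ.step m • w m + τ.jump u₀ u m = F m := by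
    intro m hm
    rw [hwdef, smul_smul, mul_inv_cancel₀ (τ.step_pos hm).ne', one_smul]
    exact sub_add_cancel _ _
  have hw : ∀ m < τ.M, ∀ v : H10 Ω,
      τ.avgOp a m (u (τ.node (m + 1))) v = ⟪w m, toL2 v⟫ := by
    intro m hm v
    have h := hu.euler τ hf hm v
    rw [hwdef, real_inner_smul_left, inner_sub_left, ← h, add_sub_cancel_left,
      inv_mul_cancel_left₀ (τ.step_pos hm).ne']
  refine ⟨w, hw, ?_⟩
  set ℓ := Real.log (T / τ.kmax)
  have hℓ : 1 ≤ ℓ := hτ.one_le_log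
  have hκ1 : 1 ≤ κ' := le_max_left _ _
  have hκ2 : κ ≤ κ' := le_max_right _ _
  have key := sum_step_mul_norm_operator_le (ι := (toL2L Ω : H10 Ω →ₗ[ℝ] L2 Ω))
    (A := τ.avgForm ha) (g := fun v => ‖weakGrad v‖) (t := τ.node)
    (U := fun m => u (τ.node (m + 1))) (F := F) (P := τ.previous u₀ u) (w := w)
    (L := L₀ * ℓ) τ.M_pos τ.node_lt (T := T) (κ := κ') (ρ := ρ) (α := α)
    (fun l hl => by linarith [τ.node_le le_rfl, τ.node_nonneg hl.le])
    hκ1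
    (fun m hm => by
      have h1 := (hτ.ratio m hm).2
      have h2 := τ.step_pos hm
      rw [div_le_iff₀ h2] at h1
      exact h1.trans (mul_le_mul_of_nonneg_right hκ2 h2.le))
    (fun m hm => by
      have h1 := (hτ.ratio m hm).1
      have h2 := τ.step_pos hm
      rw [le_div_iff₀ h2, inv_mul_le_iff₀ hκ] at h1
      exact h1.trans (mul_le_mul_of_nonneg_right hκ2 (τ.step_pos (by omega)).le))
    (fun m hm x y => by
      rw [τ.avgForm_apply ha hm, τ.avgForm_apply ha hm, τ.avgOp_symm ha hm])
    hα (fun m hm => τ.le_avgForm_self ha hm) (fun v => norm_nonneg _)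
    (fun m hm k hk h => τ.exists_resolvent_avgForm ha hα hm hk h)
    hρ0 hρa hρi (fun n hn l hl x y => τ.abs_avgForm_sub_le ha hω hn hl x y)
    (fun m => rfl)
    (fun m hm v => by
      rw [τ.avgForm_apply ha hm]
      exact hu.euler τ hf hm v)
    (fun m hm v => by
      rw [τ.avgForm_apply ha hm]
      exact hw m hm v)
    hw' (fun l hl => hτ.log_le τ hc hl hl)
  rw [← hE] at key
  have hF : ∑ m ∈ Finset.range τ.M, ‖F m‖ ≤ ∫ t in Ioc 0 T, ‖f t‖ := by
    rw [← τ.sum_integral_Ioc_node hf.norm]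
    exact Finset.sum_le_sum fun m _ => norm_integral_le_integral_norm _
  set N := (∫ t in Ioc 0 T, ‖f t‖) + ‖u₀‖ with hN
  have hD : ‖τ.previous u₀ u 0‖ + ∑ m ∈ Finset.range τ.M, ‖F m‖ ≤ N := by
    rw [hN, add_comm]
    exact add_le_add hF le_rfl
  have hjump : ∀ m ∈ Finset.range τ.M,
      τ.step m * ‖w m‖ + ‖τ.jump u₀ u m‖ ≤ 2 * (τ.step m * ‖w m‖) + ‖F m‖ := by
    intro m hm
    have hm := Finset.mem_range.mp hm
    rw [eq_sub_of_add_eq' (hw' m hm)]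
    have h1 := norm_sub_le (F m) (τ.step m • w m)
    rw [norm_smul, Real.norm_of_nonneg (τ.step_pos hm).le] at h1
    linarith
  have hN0 : 0 ≤ N := le_trans (add_nonneg (norm_nonneg _)
    (Finset.sum_nonneg fun _ _ => norm_nonneg _)) hD
  have hkey : ∑ m ∈ Finset.range τ.M, τ.step m * ‖w m‖ ≤ (L₀ + E) * ℓ * N := by
    refine key.trans (mul_le_mul ?_ hD (add_nonneg (norm_nonneg _)
      (Finset.sum_nonneg fun _ _ => norm_nonneg _)) (by positivity))
    have := mul_le_mul_of_nonneg_left hℓ hE0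
    linarith
  have hexp : 1 ≤ Real.exp (μ * T) := Real.one_le_exp (by nlinarith)
  calc _ ≤ ∑ m ∈ Finset.range τ.M, (2 * (τ.step m * ‖w m‖) + ‖F m‖) := Finset.sum_le_sum hjump
    _ = 2 * ∑ m ∈ Finset.range τ.M, τ.step m * ‖w m‖ + ∑ m ∈ Finset.range τ.M, ‖F m‖ := by
      rw [Finset.sum_add_distrib, Finset.mul_sum]
    _ ≤ 2 * ((L₀ + E) * ℓ * N) + ℓ * N := by
      have h1 : ∑ m ∈ Finset.range τ.M, ‖F m‖ ≤ N := by
        linarith [norm_nonneg (τ.previous u₀ u 0)]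
      have h2 := mul_le_mul_of_nonneg_right hℓ hN0
      linarith
    _ = (2 * (L₀ + E) + 1) * 1 * ℓ * N := by ring
    _ ≤ (2 * (L₀ + E) + 1) * Real.exp (μ * T) * ℓ * N := by gcongr
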